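/- Let $\mathfrak g$ be a finite-dimensional complex semisimple Lie algebra and let $G$ be its adjoint group, i.e. the group generated by the automorphisms $\exp(\mathrm{ad}\,y)$, $y\in\mathfrak g$. Fix a Cartan subalgebra $\mathfrak h$ with root system $\Delta$, Weyl group $W$, a choice $\Delta^+$ of positive roots and the basis $\Sigma$ of simple roots. Let $\langle\cdot,\cdot\rangle$ be the Killing form and for $\alpha\in\Delta$ let $H_\alpha\in\mathfrak h$ be defined by $\langle h,H_\alpha\rangle=\alpha(h)$ for all $h\in\mathfrak h$. Fix a Weyl basis, i.e. root vectors $E_\alpha$ ($\alpha\in\Delta$) with $[E_\alpha,E_{-\alpha}]=H_\alpha$ and $[E_\alpha,E_\beta]=m_{\alpha,\beta}E_{\alpha+\beta}$ whenever $\alpha+\beta\in\Delta$, where $m_{-\alpha,-\beta}=-m_{\alpha,\beta}$. Put $$\mathfrak a=\mathrm{span}_{\mathbb R}\{H_\alpha:\alpha\in\Delta\},\qquad \mathfrak k=\mathrm{span}_{\mathbb R}\{iH_\alpha,\ E_\alpha-E_{-\alpha},\ i(E_\alpha+E_{-\alpha}):\alpha\in\Delta^+\},\qquad \mathfrak n=\bigoplus_{\alpha\in\Delta^+}\mathfrak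 g_\alpha .$$ Let $\theta$ be the complex conjugation of $\mathfrak g$ with fixed point set $\mathfrak k$ (so $H_\alpha\mapsto-H_\alpha$, $E_\alpha\mapsto -E_{-\alpha}$), and let $\eta_0$ be the conjugate-linear map with $\eta_0(H_\alpha)=H_\alpha$ and $\eta_0(E_\alpha)=E_\alpha$ for all $\alpha\in\Delta$. A real form of $\mathfrak g$ is identified with its conjugation, a conjugate-linear involutive Lie algebra automorphism $\tau$ of $\mathfrak g$; $V^\tau$ denotes the $\tau$-fixed points of $V$. It is Iwasawa relative to $(\mathfrak k,\mathfrak a,\mathfrak n)$ if (1) $\tau\theta=\theta\tau$ and $\tau(\mathfrak h)=\mathfrak h$; (2) $\mathfrak a^\tau$ is maximal abelian in $(i\mathfrak k)^\tau$; (3) $\tau(\alpha)\in\Delta^+$ for every $\alpha\in\Delta^+$ with $\alpha|_{\mathfrak a^\tau}\ne0$, where $\tau(\alpha)(\lambda)=\alpha(\tau(\lambda))$ for $\lambda\in\mathfrak a$. For an automorphism $d$ of the Dynkin diagram of $\mathfrak g$ with $d^2=1$, $\tau$ is in the $d$-inner class if the class of $\tau\theta$ in $\mathrm{Aut}(\mathfrak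 g)/G$, which is identified with the automorphism group of the Dynkin diagram, is $d$; that is, for some $g\in G$ the automorphism $g\tau\theta$ preserves $\mathfrak h$ and maps $\mathfrak g_\alpha$ onto $\mathfrak g_{d\alpha}$ for every $\alpha\in\Sigma$. Let $\tau$ be a real form that is Iwasawa relative to $(\mathfrak k,\mathfrak a,\mathfrak n)$ and lies in the $d$-inner class. Then $$\Delta_0:=\{\alpha\in\Delta:\alpha|_{\mathfrak a^\tau}=0\}=\{\alpha\in\Delta:\tau(\alpha)=-\alpha\}.$$ Let $w^0$ be the longest element of $W$, and let $w_0$ be the longest element of the subgroup of $W$ generated by the reflections in the roots of $\Delta_0$. There is a unique automorphism $\gamma_{-w^0d}$ of the complex Lie algebra $\mathfrak g$ with $\gamma_{-w^0d}(H_\alpha)=H_{-w^0d\alpha}$ and $\gamma_{-w^0d}(E_\alpha)=E_{-w^0d\alpha}$ for all $\alpha\in\Sigma$; and, with $\tau_d=\eta_0\,\gamma_{-w^0d}$, there is a representative $\dot w_0\in G$ of $w_0$ such that $$\tau=\mathrm{Ad}_{\dot w_0}\,\tau_d .$$ -/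

import Mathlib

open LieAlgebra LieAlgebra.IsKilling Module
open scoped Pointwise ComplexConjugate

noncomputable section

namespace RealFormTheory

/-! ### The adjoint group -/

section AdjointGroup

variable (L : Type*) [LieRing L] [LieAlgebra ℂ L] [FiniteDimensional ℂ L]

/-- `e = exp (ad y)` as endomorphisms of `L`; the exponential is Mathlib's exponential of matrices,
read in a basis of `L` (it does not depend on the basis). -/
def IsExpAd (y : L) (e : L ≃ₗ[ℂ] L) : Prop :=
  LinearMap.toMatrix (finBasis ℂ L) (finBasis ℂ L) (e : L →ₗ[ℂ] L) =
    NormedSpace.exp (LinearMap.toMatrix (finBasis ℂ L) (finBasis ℂ L) (LieAlgebra.ad ℂ L y))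

/-- The adjoint group `G = Int(L)`: the subgroup of `GL(L)` generated by all `exp (ad y)`. -/
def adjointGroup : Subgroup (L ≃ₗ[ℂ] L) :=
  Subgroup.closure {e | ∃ y : L, IsExpAd L y e}

end AdjointGroup

/-! ### Real forms -/

/-- A real form of `L`, given by its conjugation: a conjugate-linear involutive automorphism of the
Lie algebra `L`. The real form itself is the set of fixed points. -/
structure RealForm (L : Type*) [LieRing L] [LieAlgebra ℂ L] extends L →ₛₗ[starRingEnd ℂ] L where
  map_lie' : ∀ x y : L, toFun ⁅x, y⁆ = ⁅toFun x, toFun y⁆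
  involutive' : Function.Involutive toFun

namespace RealForm

variable {L : Type*} [LieRing L] [LieAlgebra ℂ L]

instance : CoeFun (RealForm L) (fun _ => L → L) := ⟨fun τ => τ.toFun⟩

/-- The real subspace of `L` of fixed points of `τ`. -/
def fixed (τ : RealForm L) : Submodule ℝ L where
  carrier := {x | τ x = x}
  add_mem' := by
    intro x y hx hy
    have h := τ.toLinearMap.map_add x y
    simp only [Set.mem_ofPred_eq] at hx hy ⊢
    exact h.trans (congrArg₂ (· + ·) hx hy)
  zero_mem' := τ.toLinearMap.map_zero
  smul_mem' := by
    intro c x hx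
    have h := τ.toLinearMap.map_smulₛₗ (c : ℂ) x
    simp only [Set.mem_ofPred_eq, Complex.conj_ofReal] at hx h ⊢
    exact h.trans (congrArg ((c : ℂ) • ·) hx)

end RealForm

/-! ### Roots, Weyl bases and the attached real subspaces -/

section Roots

variable {L : Type*} [LieRing L] [LieAlgebra ℂ L] [FiniteDimensional ℂ L] [IsKilling ℂ L]
variable {H : LieSubalgebra ℂ L} [H.IsCartanSubalgebra]

/-- The root `-α`. -/
def negRoot (α : H.root) : H.root :=
  ⟨-α.1, by simpa using H.isNonZero_coe_root α⟩

/-- The element `H_α` of the Cartan subalgebra that represents the root `α` through the Killing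
form: `⟪h, H_α⟫ = α h` for all `h` in `H`. -/
def rootVec (α : H.root) : H :=
  (cartanEquivDual H).symm ((rootSystem H).root α)

variable (H) in
/-- A Weyl basis: root vectors `E_α` with `[E_α, E_{-α}] = H_α` and `[E_α, E_β] = m_{α,β} E_{α+β}`
whenever `α + β` is a root, where `m_{-α,-β} = -m_{α,β}`. -/
structure WeylBasis where
  E : H.root → L
  E_mem : ∀ α : H.root, E α ∈ rootSpace H α.1
  lie_E_neg : ∀ α : H.root, ⁅E α, E (negRoot α)⁆ = (rootVec α : L)
  m : H.root → H.root → ℂ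
  lie_E : ∀ α β γ : H.root, (rootSystem H).root γ = (rootSystem H).root α + (rootSystem H).root β →
    ⁅E α, E β⁆ = m α β • E γ
  m_neg : ∀ α β γ : H.root, (rootSystem H).root γ = (rootSystem H).root α + (rootSystem H).root β →
    m (negRoot α) (negRoot β) = - m α β

variable (H) in
/-- The real subspace `𝔞`, spanned over `ℝ` by the `H_α`. -/
def splitTorus : Submodule ℝ L :=
  Submodule.span ℝ (Set.range fun α : H.root => (rootVec α : L))

namespace WeylBasis

variable (X : WeylBasis H) (b : (rootSystem H).Base)

/-- The compact real form `𝔨`, spanned over `ℝ` by `i H_α`, `E_α - E_{-α}` and `i (E_α + E_{-α})`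
for positive roots `α`. -/
def compactSubspace : Submodule ℝ L :=
  Submodule.span ℝ {x | ∃ α : H.root, b.IsPos α ∧
    (x = Complex.I • (rootVec α : L) ∨
     x = X.E α - X.E (negRoot α) ∨
     x = Complex.I • (X.E α + X.E (negRoot α)))}

/-- For a finite family of vectors `v` and linear forms `f`, the conjugate-linear map
`x ↦ ∑ conj (f x) v`. -/
def conjSum {ι : Type*} [Fintype ι] (f : ι → L →ₗ[ℂ] ℂ) (v : ι → L) :
    L →ₛₗ[starRingEnd ℂ] L where
  toFun x := ∑ i, conj (f i x) • v i
  map_add' x y := by simp [add_smul, Finset.sum_add_distrib]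
  map_smul' c x := by simp [mul_smul, Finset.smul_sum]

/-- The split real form `η₀`: the conjugate-linear map that fixes every `H_α` and every `E_α`.
Every `x` in `L` is `∑ ⟪H_α, x⟫ H_α + ∑ ⟪E_{-α}, x⟫ E_α`, sums over all roots. -/
def splitForm : L →ₛₗ[starRingEnd ℂ] L :=
  conjSum (fun α : H.root => killingForm ℂ L (rootVec α : L)) (fun α => (rootVec α : L)) +
  conjSum (fun α : H.root => killingForm ℂ L (X.E (negRoot α))) (fun α => X.E α)

/-- The conjugation `θ` of `L` with respect to the compact real form `𝔨`: the conjugate-linear map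
with `H_α ↦ -H_α` and `E_α ↦ -E_{-α}`. -/
def compactConj : L →ₛₗ[starRingEnd ℂ] L :=
  -(conjSum (fun α : H.root => killingForm ℂ L (rootVec α : L)) (fun α => (rootVec α : L)) +
    conjSum (fun α : H.root => killingForm ℂ L (X.E (negRoot α))) (fun α => X.E (negRoot α)))

/-! The next facts check that `η₀` and `θ` are what their descriptions say. -/

lemma rootVec_form (α : H.root) (h : H) :
    killingForm ℂ L (rootVec α : L) (h : L) = α.1 h := by
  have : cartanEquivDual H (rootVec α) h = (rootSystem H).root α h := by
    rw [rootVec, LinearEquiv.apply_symm_apply]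
  exact this

lemma negRoot_negRoot (α : H.root) : negRoot (negRoot α) = α := by
  ext1; simp [negRoot]

lemma rootVec_form_E (X : WeylBasis H) (α β : H.root) :
    killingForm ℂ L (rootVec α : L) (X.E β) = 0 := by
  have h0 : (rootVec α : L) ∈ rootSpace H (0 : H → ℂ) := by
    simp
  apply killingForm_apply_eq_zero_of_mem_rootSpace_of_add_ne_zero ℂ L H h0 (X.E_mem β)
  simp

lemma E_form_cartan (X : WeylBasis H) (β : H.root) (h : H) :
    killingForm ℂ L (X.E β) (h : L) = 0 := by
  have h0 : (h : L) ∈ rootSpace H (0 : H → ℂ) := by simp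
  apply killingForm_apply_eq_zero_of_mem_rootSpace_of_add_ne_zero ℂ L H (X.E_mem β) h0
  simp

lemma rootVec_ne_zero (α : H.root) : rootVec α ≠ 0 := by
  simp [rootVec]

open scoped Classical in
lemma E_form_E (X : WeylBasis H) (α β : H.root) :
    killingForm ℂ L (X.E (negRoot α)) (X.E β) = if α = β then 1 else 0 := by
  split_ifs with hαβ
  · subst hαβ
    have h1 := lie_eq_killingForm_smul_of_mem_rootSpace_of_mem_rootSpace_neg
      (X.E_mem α) (X.E_mem (negRoot α))
    rw [X.lie_E_neg] at h1
    have h2 : (rootVec α : L) = killingForm ℂ L (X.E α) (X.E (negRoot α)) • (rootVec α : L) := h1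
    have h3 : (rootVec α : L) ≠ 0 := by simpa using rootVec_ne_zero α
    have h4 : (1 - killingForm ℂ L (X.E α) (X.E (negRoot α))) • (rootVec α : L) = 0 := by
      rw [sub_smul, one_smul, ← h2, sub_self]
    rw [smul_eq_zero, or_iff_left h3, sub_eq_zero] at h4
    rw [h4]
    exact LieModule.traceForm_comm ℂ L L _ _
  · apply killingForm_apply_eq_zero_of_mem_rootSpace_of_add_ne_zero ℂ L H
      (X.E_mem (negRoot α)) (X.E_mem β)
    intro h
    apply hαβ
    ext1
    ext1 x
    have := congrFun h x
    simp [negRoot] at this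
    linear_combination -this

lemma sum_rootVec (h : H) : ∑ α : H.root, α.1 h • (rootVec α : L) = h := by
  have key : ∑ α : H.root, α.1 h • rootVec α = h := by
    apply (cartanEquivDual H).injective
    ext h'
    have h1 : ∀ α : H.root, cartanEquivDual H (rootVec α) h' = α.1 h' := fun α => by
      rw [rootVec, LinearEquiv.apply_symm_apply]; rfl
    have h2 := LinearMap.congr_fun (LinearMap.congr_fun
      (restrict_killingForm_eq_sum (K := ℂ) (L := L) (H := H)) h) h'
    rw [← Finset.sum_coe_sort (s := H.root)] at h2
    have h3 : cartanEquivDual H h h' = ∑ α : H.root, α.1 h * α.1 h' := by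
      refine Eq.trans h2 ?_
      simp only [LinearMap.sum_apply]
      rfl
    rw [h3, map_sum, LinearMap.sum_apply]
    exact Finset.sum_congr rfl fun α _ => by rw [map_smul, LinearMap.smul_apply, h1, smul_eq_mul]
  simpa using congrArg (fun y : H => (y : L)) key

lemma rootVec_negRoot (α : H.root) : rootVec (negRoot α) = -rootVec α := by
  rw [rootVec, rootVec, ← map_neg]
  rfl

lemma conj_root_rootVec (α β : H.root) : conj (α.1 (rootVec β)) = α.1 (rootVec β) := by
  set q : ℂ := β.1 (rootVec β) with hq
  have hq0 : q ≠ 0 := root_apply_cartanEquivDual_symm_ne_zero (H.isNonZero_coe_root β)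
  have hn : ∀ γ : H.root, ∃ n : ℤ, γ.1 (rootVec β) = n * q / 2 := fun γ => by
    have h1 := apply_coroot_eq_cast β.1 γ.1
    have h2 : γ.1 (coroot β.1) = 2 * (q⁻¹ * γ.1 (rootVec β)) := by
      have : coroot β.1 = (2 : ℂ) • (q⁻¹ • rootVec β) := by
        rw [coroot, ← Nat.cast_smul_eq_nsmul ℂ]
        rfl
      rw [this]
      simp
    rw [h2] at h1
    refine ⟨(LieModule.chainBotCoeff β.1 γ.1 : ℤ) - LieModule.chainTopCoeff β.1 γ.1, ?_⟩
    rw [← h1]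
    field_simp
  choose n hn using hn
  have hsum : q = ∑ γ : H.root, γ.1 (rootVec β) * γ.1 (rootVec β) := by
    have h1 := congrArg (killingForm ℂ L (rootVec β : L)) (sum_rootVec (rootVec β))
    rw [rootVec_form, map_sum] at h1
    rw [hq, ← h1]
    refine Finset.sum_congr rfl fun γ _ => ?_
    rw [map_smul, smul_eq_mul, LieModule.traceForm_comm, rootVec_form]
  have hq1 : q * (∑ γ : H.root, (n γ : ℂ) * n γ) = 4 := by
    have h1 : q = q * q / 4 * ∑ γ : H.root, (n γ : ℂ) * n γ := by
      rw [Finset.mul_sum]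
      refine hsum.trans (Finset.sum_congr rfl fun γ _ => ?_)
      rw [hn γ]; ring
    have h2 : q * (q * (∑ γ : H.root, (n γ : ℂ) * n γ) - 4) = 0 := by linear_combination -4 * h1
    exact sub_eq_zero.mp ((mul_eq_zero.mp h2).resolve_left hq0)
  have hqc : conj q = q := by
    have h1 := congrArg conj hq1
    simp only [map_mul, map_sum, map_intCast, map_ofNat] at h1
    have h2 : (∑ γ : H.root, (n γ : ℂ) * n γ) ≠ 0 := by
      intro h; rw [h] at hq1; norm_num at hq1
    exact mul_right_cancel₀ h2 (h1.trans hq1.symm)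
  rw [hn α, map_div₀, map_mul, map_intCast, hqc, map_ofNat]

/-- Every `x` in `L` is `∑ ⟪H_α, x⟫ H_α + ∑ ⟪E_{-α}, x⟫ E_α`. -/
lemma expansion (X : WeylBasis H) (x : L) :
    ∑ α : H.root, killingForm ℂ L (rootVec α : L) x • (rootVec α : L) +
      ∑ α : H.root, killingForm ℂ L (X.E (negRoot α)) x • X.E α = x := by
  classical
  have hx : x ∈ ⨆ χ : LieModule.Weight ℂ H L, rootSpace H χ := by
    rw [LieModule.iSup_genWeightSpace_eq_top' ℂ H L]; trivial
  induction hx using LieSubmodule.iSup_induction' with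
  | mem χ x hx =>
    by_cases hχ : χ.IsZero
    · have hxH : x ∈ H := by
        have : (χ : H → ℂ) = 0 := hχ
        rw [this] at hx
        simpa using hx
      have h1 := sum_rootVec (⟨x, hxH⟩ : H)
      have h2 : ∑ α : H.root, killingForm ℂ L (X.E (negRoot α)) x • X.E α = 0 :=
        Finset.sum_eq_zero fun α _ => by
          rw [E_form_cartan X (negRoot α) ⟨x, hxH⟩, zero_smul]
      rw [h2, add_zero]
      refine Eq.trans (Finset.sum_congr rfl fun α _ => ?_) h1
      rw [← rootVec_form α ⟨x, hxH⟩]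
    · let β : H.root := ⟨χ, by simpa using hχ⟩
      have hE : X.E β ≠ 0 := fun h => by
        have := X.lie_E_neg β
        rw [h, zero_lie] at this
        exact rootVec_ne_zero β (by simpa using this.symm)
      obtain ⟨c, rfl⟩ : ∃ c : ℂ, c • X.E β = x := by
        have h1 := finrank_rootSpace_eq_one χ hχ
        have h2 := (finrank_eq_one_iff_of_nonzero' (K := ℂ)
          (⟨X.E β, X.E_mem β⟩ : rootSpace H χ) (by simpa using hE)).mp h1 ⟨x, hx⟩
        obtain ⟨c, hc⟩ := h2
        exact ⟨c, by simpa using congrArg Subtype.val hc⟩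
      simp [rootVec_form_E, E_form_E]
  | zero => simp
  | add x y _ _ hx hy =>
    simp only [map_add, add_smul, Finset.sum_add_distrib]
    rw [add_add_add_comm, hx, hy]

variable (X : WeylBasis H)

lemma splitForm_E (β : H.root) : X.splitForm (X.E β) = X.E β := by
  classical
  simp [splitForm, conjSum, rootVec_form_E, E_form_E, apply_ite]

lemma splitForm_rootVec (β : H.root) : X.splitForm (rootVec β : L) = (rootVec β : L) := by
  simpa [splitForm, conjSum, E_form_cartan, rootVec_form, conj_root_rootVec] using sum_rootVec (rootVec β)

lemma compactConj_E (β : H.root) : X.compactConj (X.E β) = -X.E (negRoot β) := by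
  classical
  simp [compactConj, conjSum, rootVec_form_E, E_form_E, apply_ite]

lemma compactConj_rootVec (β : H.root) : X.compactConj (rootVec β : L) = -(rootVec β : L) := by
  simpa [compactConj, conjSum, E_form_cartan, rootVec_form, conj_root_rootVec] using sum_rootVec (rootVec β)

lemma isPos_or_isPos_negRoot (b : (rootSystem H).Base) (α : H.root) :
    b.IsPos α ∨ b.IsPos (negRoot α) := by
  have h := RootPairing.Base.IsPos.or_neg b α
  have : (rootSystem H).reflectionPerm α α = negRoot α := by
    apply (rootSystem H).root.injective
    rw [(rootSystem H).root_reflectionPerm, (rootSystem H).reflection_apply_self]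
    rfl
  simpa [this] using h

/-- The fixed points of `θ` are exactly the elements of `𝔨`. -/
theorem compactConj_eq_self_iff (b : (rootSystem H).Base) (x : L) :
    X.compactConj x = x ↔ x ∈ X.compactSubspace b := by
  have hI : ∀ c : ℝ, ∀ v : L, (c : ℂ) • v = c • v := fun c v => rfl
  constructor
  · intro h
    have hH : ∀ α : H.root, Complex.I • (rootVec α : L) ∈ X.compactSubspace b := fun α => by
      rcases isPos_or_isPos_negRoot b α with hα | hα
      · exact Submodule.subset_span ⟨α, hα, Or.inl rfl⟩
      · have : Complex.I • (rootVec (negRoot α) : L) ∈ X.compactSubspace b :=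
          Submodule.subset_span ⟨_, hα, Or.inl rfl⟩
        rw [rootVec_negRoot] at this
        simpa using this
    have hX : ∀ α : H.root, X.E α - X.E (negRoot α) ∈ X.compactSubspace b := fun α => by
      rcases isPos_or_isPos_negRoot b α with hα | hα
      · exact Submodule.subset_span ⟨α, hα, Or.inr (Or.inl rfl)⟩
      · have : X.E (negRoot α) - X.E (negRoot (negRoot α)) ∈ X.compactSubspace b :=
          Submodule.subset_span ⟨_, hα, Or.inr (Or.inl rfl)⟩
        rw [negRoot_negRoot] at this
        simpa using Submodule.neg_mem _ this
    have hY : ∀ α : H.root, Complex.I • (X.E α + X.E (negRoot α)) ∈ X.compactSubspace b :=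
      fun α => by
      rcases isPos_or_isPos_negRoot b α with hα | hα
      · exact Submodule.subset_span ⟨α, hα, Or.inr (Or.inr rfl)⟩
      · have : Complex.I • (X.E (negRoot α) + X.E (negRoot (negRoot α))) ∈ X.compactSubspace b :=
          Submodule.subset_span ⟨_, hα, Or.inr (Or.inr rfl)⟩
        rwa [negRoot_negRoot, add_comm] at this
    have hmain : x + X.compactConj x ∈ X.compactSubspace b := by
      have he := expansion X x
      have : x + X.compactConj x =
          ∑ α : H.root, (2 * (killingForm ℂ L (rootVec α : L) x).im) •
              (Complex.I • (rootVec α : L)) +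
          ∑ α : H.root, ((killingForm ℂ L (X.E (negRoot α)) x).re • (X.E α - X.E (negRoot α)) +
            (killingForm ℂ L (X.E (negRoot α)) x).im •
              (Complex.I • (X.E α + X.E (negRoot α)))) := by
        nth_rewrite 1 [← he]
        simp only [compactConj, conjSum, LinearMap.neg_apply, LinearMap.add_apply,
          LinearMap.coe_mk, AddHom.coe_mk]
        rw [neg_add, add_add_add_comm, ← sub_eq_add_neg, ← sub_eq_add_neg,
          ← Finset.sum_sub_distrib, ← Finset.sum_sub_distrib]
        congr 1
        · refine Finset.sum_congr rfl fun α _ => ?_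
          rw [← hI, smul_smul, ← sub_smul]
          congr 1
          apply Complex.ext <;> (simp; try ring)
        · refine Finset.sum_congr rfl fun α _ => ?_
          generalize killingForm ℂ L (X.E (negRoot α)) x = z
          have hz : z = (z.re : ℂ) + z.im * Complex.I := (Complex.re_add_im z).symm
          have hz' : conj z = (z.re : ℂ) - z.im * Complex.I := by
            apply Complex.ext <;> simp
          rw [← hI, ← hI, hz']
          nth_rewrite 1 [hz]
          module
      rw [this]
      refine Submodule.add_mem _ (Submodule.sum_mem _ fun α _ => Submodule.smul_mem _ _ (hH α))
        (Submodule.sum_mem _ fun α _ => Submodule.add_mem _ (Submodule.smul_mem _ _ (hX α))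
          (Submodule.smul_mem _ _ (hY α)))
    rw [h] at hmain
    have : (2⁻¹ : ℝ) • (x + x) = x := by
      rw [← two_smul ℝ x, smul_smul]; norm_num
    rw [← this]
    exact Submodule.smul_mem _ _ hmain
  · intro h
    induction h using Submodule.span_induction with
    | mem x hx =>
      obtain ⟨α, -, rfl | rfl | rfl⟩ := hx
      · simp [compactConj_rootVec]
      · simp only [map_sub, compactConj_E, negRoot_negRoot]; abel
      · simp only [map_smulₛₗ, map_add, compactConj_E, negRoot_negRoot, Complex.conj_I]; module
    | zero => simp
    | add x y _ _ hx hy => rw [map_add, hx, hy]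
    | smul c x _ hx =>
      rw [← hI, map_smulₛₗ, hx, Complex.conj_ofReal]

end WeylBasis

/-! ### The Weyl group -/

/-- The length of `w` with respect to the simple reflections: the least length of a word in the
simple reflections with product `w`. -/
def simpleLength (b : (rootSystem H).Base) (w : (rootSystem H).Aut) : ℕ :=
  sInf {n | ∃ l : List b.support, l.length = n ∧
    (l.map fun i => RootPairing.Equiv.reflection (rootSystem H) i).prod = w}

/-- The group of automorphisms of the root system is finite. -/
lemma finite_aut : Finite (rootSystem H).Aut := by
  refine Finite.of_injective (fun w : (rootSystem H).Aut => w.indexEquiv) fun w w' h => ?_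
  apply RootPairing.Equiv.weightHom_injective
  apply LinearEquiv.toLinearMap_injective
  refine LinearMap.ext_on_range (RootPairing.IsRootSystem.span_root_eq_top (P := rootSystem H))
    fun α => ?_
  have h1 := RootPairing.Equiv.root_indexEquiv_eq_smul (P := rootSystem H) α w
  have h2 := RootPairing.Equiv.root_indexEquiv_eq_smul (P := rootSystem H) α w'
  have h' : w.indexEquiv = w'.indexEquiv := h
  rw [h'] at h1
  exact h1.symm.trans h2

/-- `w` is an element of maximal length in the subgroup `W'` of the Weyl group. -/
def IsLongest (b : (rootSystem H).Base) (W' : Subgroup (rootSystem H).Aut)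
    (w : (rootSystem H).Aut) : Prop :=
  w ∈ W' ∧ ∀ v ∈ W', simpleLength b v ≤ simpleLength b w

lemma exists_isLongest (b : (rootSystem H).Base) (W' : Subgroup (rootSystem H).Aut) :
    ∃ w, IsLongest b W' w := by
  have := finite_aut (H := H)
  obtain ⟨w, hw, hmax⟩ := Set.exists_max_image (W' : Set (rootSystem H).Aut) (simpleLength b)
    (Set.toFinite _) ⟨1, W'.one_mem⟩
  exact ⟨w, hw, hmax⟩

/-- The longest element of the subgroup `W'` of the Weyl group. -/
def longestElement (b : (rootSystem H).Base) (W' : Subgroup (rootSystem H).Aut) :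
    (rootSystem H).Aut :=
  (exists_isLongest b W').choose

/-- The linear automorphism `n` of `L` represents the Weyl group element `w`: it preserves `H` and
acts on it by `w`, that is `(w α) (n h) = α h` for all roots `α` and all `h` in `H`. -/
def Represents (n : L ≃ₗ[ℂ] L) (w : (rootSystem H).Aut) : Prop :=
  ∃ hn : ∀ h : H, n h ∈ H, ∀ (α : H.root) (h : H), (w.indexEquiv α).1 ⟨n h, hn h⟩ = α.1 h

/-! ### Diagram automorphisms and inner classes -/

/-- `d` is an automorphism of the Dynkin diagram: a permutation of the simple roots that preserves
the Cartan integers. -/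
def IsDiagramAut (b : (rootSystem H).Base) (d : Equiv.Perm b.support) : Prop :=
  ∀ i j, b.cartanMatrix (d i) (d j) = b.cartanMatrix i j

/-- The class of the automorphism `φ` of `L` in `Aut(L) / G`, which is the automorphism group of the
Dynkin diagram, is `d`: after composition with an element of `G`, `φ` preserves `H` and maps the
root space of each simple root `α` onto that of `d α`. -/
def HasOuterClass (b : (rootSystem H).Base) (φ : L ≃ₗ⁅ℂ⁆ L) (d : Equiv.Perm b.support) : Prop :=
  ∃ g ∈ adjointGroup L, (fun x => g (φ x)) '' (H : Set L) = H ∧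
    ∀ i : b.support, (fun x => g (φ x)) '' (rootSpace H (i : H.root).1 : Set L) =
      rootSpace H (d i : H.root).1

variable (X : WeylBasis H) (b : (rootSystem H).Base)

/-- The real form `τ` is in the `d`-inner class: the automorphism `τ θ` has outer class `d`. -/
def IsInInnerClass (τ : RealForm L) (d : Equiv.Perm b.support) : Prop :=
  ∃ φ : L ≃ₗ⁅ℂ⁆ L, (∀ x, φ x = τ (X.compactConj x)) ∧ HasOuterClass b φ d

/-- The element `-w⁰ d α` for a simple root `α`, where `w⁰` is the longest element of the Weyl
group. -/
def negLongest (d : Equiv.Perm b.support) (i : b.support) : H.root :=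
  negRoot ((longestElement b (rootSystem H).weylGroup).indexEquiv (d i))

/-- `γ` is the lift `γ_c` to `Aut(L)` of the map `c` on simple roots: `H_α ↦ H_{c α}` and
`E_α ↦ E_{c α}` for each simple root `α`. -/
def IsDiagramLift (c : b.support → H.root) (γ : L ≃ₗ⁅ℂ⁆ L) : Prop :=
  ∀ i : b.support, γ (rootVec (i : H.root) : L) = (rootVec (c i) : L) ∧
    γ (X.E i) = X.E (c i)

/-! ### Iwasawa real forms -/

variable (H) in
/-- `𝔞^τ`. -/
def fixedTorus (τ : RealForm L) : Submodule ℝ L :=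
  splitTorus H ⊓ τ.fixed

/-- `τ` is an Iwasawa real form relative to `(𝔨, 𝔞, 𝔫)`: it is normally related to `(𝔨, 𝔞)` and
compatible with the positive roots. For a root `α`, the root `τ α` is given on `𝔞` by
`(τ α) h = α (τ h)`. -/
structure IsIwasawa (τ : RealForm L) : Prop where
  comm : ∀ x, τ (X.compactConj x) = X.compactConj (τ x)
  map_cartan : (fun x => τ x) '' (H : Set L) = H
  maximal : Maximal (fun V : Submodule ℝ L =>
    V ≤ (Complex.I • X.compactSubspace b) ⊓ τ.fixed ∧ ∀ x ∈ V, ∀ y ∈ V, ⁅x, y⁆ = 0)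
    (fixedTorus H τ)
  compatible : ∀ α : H.root, b.IsPos α → (∃ h : H, (h : L) ∈ fixedTorus H τ ∧ α.1 h ≠ 0) →
    ∃ β : H.root, b.IsPos β ∧
      ∀ h h' : H, (h : L) ∈ splitTorus H → (h' : L) = τ h → β.1 h = α.1 h'

variable (H) in
/-- The set `Δ₀` of roots that vanish on `𝔞^τ`. -/
def vanishingRoots (τ : RealForm L) : Set H.root :=
  {α | ∀ h : H, (h : L) ∈ fixedTorus H τ → α.1 h = 0}

variable (H) in
/-- The subgroup of the Weyl group generated by the reflections in the roots of `Δ₀`. -/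
def vanishingWeylGroup (τ : RealForm L) : Subgroup (rootSystem H).Aut :=
  Subgroup.closure (RootPairing.Equiv.reflection (rootSystem H) '' vanishingRoots H τ)

end Roots
end RealFormTheory
end

/-! ### Matrix exponentials acting on vectors -/

namespace RealFormTheory

section MatrixExp

variable {ι κ : Type*} [Fintype ι] [DecidableEq ι] [Fintype κ] [DecidableEq κ]

/-! Put φ = τθ. As τ and θ commute, φ is an involutive complex automorphism; it preserves 𝔥, so it
permutes the roots by an involution π, and θ = -1 on 𝔞 gives τ(α) = -πα. The claims thus become
statements about π. First, Δ₀ is the set of roots fixed by π (`mem_vanishingRoots_iff`): if α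
vanishes on 𝔞^τ, then α and πα vanish on the τ-fixed vector H_α - H_{πα}, which has norm zero for a
form that is definite on 𝔞.

The heart is that σ = -w₀⁻¹π preserves the positive roots (`isPos_diagramPerm_apply`). The
difference ht α - ht πα is additive in α and invariant under the reflections in Δ₀. By the Iwasawa
condition it is nonnegative on positive roots and zero only on those in Δ₀. Hence the simple roots
that occur in a positive root of Δ₀ lie in Δ₀, so w₀ makes all these positive roots negative, while
outside Δ₀ the sign of a root is the sign of the difference.

The inner class then identifies σ (`diagramPerm_apply_eq_negLongest`). Some g in G makes gφ act on
simple roots as d. Composing g⁻¹ with inverse representatives of w₀ and w⁰ gives an element of G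
that preserves the positive roots, and such an element fixes every simple root
(`ActsOnRoots.apply_eq_self_of_mem_adjointGroup`), which reads σ = -w⁰d. That rigidity is a highest
weight argument. The wedge of all E_β with β positive, β ≠ α_i, is a highest weight vector of weight
2ρ - α_i; an element of G that moves α_i to α_j carries it to weight 2ρ - α_j inside the same
submodule, although this weight is not below the highest one. Tensor powers and matrix exponentials
serve to pass from stability under the Lie algebra to stability under G. The rigidity also shows
that length counts inversions, which is how longest elements are handled.

Finally, for a representative n₀ of w₀, the automorphism n₀⁻¹φθη₀ acts on the roots by σ. A torus
element t turns it into the lift γ, so existence of the lift comes from τ itself. Uniqueness of the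
lift forces γ to commute with η₀, and τ = n₀t⁻¹η₀γ follows. -/

open scoped Matrix.Norms.Operator in
theorem hasSum_matrixExp (P : Matrix ι ι ℂ) :
    HasSum (fun n : ℕ => ((n.factorial : ℂ)⁻¹) • P ^ n) (NormedSpace.exp P) :=
  NormedSpace.exp_series_hasSum_exp' (𝕂 := ℂ) P

open scoped Matrix.Norms.Operator in
theorem map_matrixExp (f : Matrix ι ι ℂ →+* Matrix κ κ ℂ) (hf : Continuous f)
    (P : Matrix ι ι ℂ) : f (NormedSpace.exp P) = NormedSpace.exp (f P) :=
  NormedSpace.map_exp f hf P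

theorem hasSum_matrixExp_mulVec (P : Matrix ι ι ℂ) (u : ι → ℂ) :
    HasSum (fun n : ℕ => ((n.factorial : ℂ)⁻¹) • (P ^ n).mulVec u)
      ((NormedSpace.exp P).mulVec u) := by
  have h := (hasSum_matrixExp P).map (Matrix.mulVec.addMonoidHomLeft u)
    (continuous_id.matrix_mulVec continuous_const)
  simpa only [Function.comp_def, Matrix.mulVec.addMonoidHomLeft, AddMonoidHom.coe_mk,
    ZeroHom.coe_mk, Matrix.smul_mulVec] using h

/-- The partial sums of the series lie in `U`, and a finite-dimensional subspace is closed. -/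
theorem matrixExp_mulVec_mem (P : Matrix ι ι ℂ) (U : Submodule ℂ (ι → ℂ))
    (hU : ∀ u ∈ U, P.mulVec u ∈ U) {u : ι → ℂ} (hu : u ∈ U) :
    (NormedSpace.exp P).mulVec u ∈ U := by
  have hpow : ∀ n : ℕ, (P ^ n).mulVec u ∈ U := fun n => by
    induction n with
    | zero => simpa
    | succ n ih => rw [pow_succ', ← Matrix.mulVec_mulVec]; exact hU _ ih
  have hclosed : IsClosed (U : Set (ι → ℂ)) := U.closed_of_finiteDimensional
  exact hclosed.mem_of_tendsto (hasSum_matrixExp_mulVec P u)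
    (Filter.Eventually.of_forall fun s => U.sum_mem fun n _ => U.smul_mem _ (hpow n))

theorem matrixExp_mulVec_of_eigen (P : Matrix ι ι ℂ) {u : ι → ℂ} {c : ℂ}
    (h : P.mulVec u = c • u) : (NormedSpace.exp P).mulVec u = Complex.exp c • u := by
  have hpow : ∀ n : ℕ, (P ^ n).mulVec u = c ^ n • u := fun n => by
    induction n with
    | zero => simp
    | succ n ih => rw [pow_succ, ← Matrix.mulVec_mulVec, h, Matrix.mulVec_smul, ih, smul_smul,
        pow_succ']
  have h1 := hasSum_matrixExp_mulVec P u
  simp only [hpow, smul_smul] at h1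
  have h2 : HasSum (fun n : ℕ => ((n.factorial : ℂ)⁻¹ * c ^ n)) (Complex.exp c) := by
    have := NormedSpace.exp_series_hasSum_exp' (𝕂 := ℂ) c
    rw [← Complex.exp_eq_exp_ℂ] at this
    simpa using this
  exact h1.unique (h2.smul_const u)

theorem matrixExp_mulVec_of_cube (P : Matrix ι ι ℂ) {u : ι → ℂ}
    (h : P.mulVec (P.mulVec (P.mulVec u)) = 0) :
    (NormedSpace.exp P).mulVec u = u + P.mulVec u + (2⁻¹ : ℂ) • P.mulVec (P.mulVec u) := by
  have hpow : ∀ n : ℕ, (P ^ (n + 3)).mulVec u = 0 := fun n => by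
    rw [pow_add, ← Matrix.mulVec_mulVec, pow_succ, pow_two, ← Matrix.mulVec_mulVec,
      ← Matrix.mulVec_mulVec, h, Matrix.mulVec_zero]
  have h1 := hasSum_matrixExp_mulVec P u
  have h2 : HasSum (fun n : ℕ => ((n.factorial : ℂ)⁻¹) • (P ^ n).mulVec u) _ :=
    hasSum_sum_of_ne_finset_zero (s := Finset.range 3) fun n hn => by
      obtain ⟨k, rfl⟩ := Nat.exists_eq_add_of_le' (by simpa using hn : 3 ≤ n)
      simp [hpow]
  rw [h1.unique h2]
  simp [Finset.sum_range_succ, pow_two, Nat.factorial, Matrix.mulVec_mulVec]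

/-- Used for linear maps that commute with `ad y`, and for the bracket as a map from the tensor
square of `L` to `L`. -/
theorem matrixExp_intertwine (P : Matrix ι ι ℂ) (Q : Matrix κ κ ℂ) (f : (ι → ℂ) →ₗ[ℂ] (κ → ℂ))
    (h : ∀ u, f (P.mulVec u) = Q.mulVec (f u)) (u : ι → ℂ) :
    f ((NormedSpace.exp P).mulVec u) = (NormedSpace.exp Q).mulVec (f u) := by
  have hpow : ∀ n : ℕ, f ((P ^ n).mulVec u) = (Q ^ n).mulVec (f u) := fun n => by
    induction n with
    | zero => simp
    | succ n ih => rw [pow_succ', pow_succ', ← Matrix.mulVec_mulVec, ← Matrix.mulVec_mulVec, h, ih]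
  have h1 := (hasSum_matrixExp_mulVec P u).mapL (LinearMap.toContinuousLinearMap f)
  simp only [LinearMap.coe_toContinuousLinearMap', map_smul, hpow] at h1
  exact h1.unique (hasSum_matrixExp_mulVec Q (f u))

end MatrixExp

/-! ### Tensor powers in coordinates -/

section TensorPower

variable {ι κ : Type*} [Fintype ι] [DecidableEq ι] [Fintype κ] [DecidableEq κ]

/-- The tensor product of a family of square matrices, acting on `(κ → ι) → ℂ`. -/
def piKronecker : (κ → Matrix ι ι ℂ) →* Matrix (κ → ι) (κ → ι) ℂ where
  toFun A := Matrix.of fun a b => ∏ j, A j (a j) (b j)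
  map_one' := by
    ext a b
    simp only [Pi.one_apply, Matrix.of_apply, Matrix.one_apply]
    by_cases h : a = b
    · simp [h]
    · obtain ⟨j, hj⟩ := Function.ne_iff.mp h
      rw [if_neg h]
      exact Finset.prod_eq_zero (Finset.mem_univ j) (if_neg hj)
  map_mul' A B := by
    ext a b
    simp only [Pi.mul_apply, Matrix.of_apply, Matrix.mul_apply, Finset.prod_univ_sum,
      Fintype.piFinset_univ, Finset.prod_mul_distrib]

theorem piKronecker_apply (A : κ → Matrix ι ι ℂ) (a b : κ → ι) :
    piKronecker A a b = ∏ j, A j (a j) (b j) := rfl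

theorem piKronecker_mulSingle_apply (j : κ) (A : Matrix ι ι ℂ) (a b : κ → ι) :
    piKronecker (Pi.mulSingle j A) a b =
      A (a j) (b j) * ∏ l ∈ Finset.univ.erase j, (1 : Matrix ι ι ℂ) (a l) (b l) := by
  rw [piKronecker_apply, ← Finset.mul_prod_erase _ _ (Finset.mem_univ j), Pi.mulSingle_eq_same]
  congr 1
  exact Finset.prod_congr rfl fun l hl => by
    rw [Pi.mulSingle_eq_of_ne (Finset.ne_of_mem_erase hl)]

/-- A matrix acting on the tensor factor with index `j`. -/
def tensorSlot (j : κ) : Matrix ι ι ℂ →+* Matrix (κ → ι) (κ → ι) ℂ where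
  toFun A := piKronecker (Pi.mulSingle j A)
  map_one' := by rw [Pi.mulSingle_one, map_one]
  map_mul' A B := by rw [Pi.mulSingle_mul, map_mul]
  map_zero' := by ext a b; simp [piKronecker_mulSingle_apply]
  map_add' A B := by ext a b; simp [piKronecker_mulSingle_apply, add_mul]

theorem continuous_tensorSlot (j : κ) : Continuous (tensorSlot (ι := ι) j) := by
  refine continuous_matrix fun a b => ?_
  simp only [tensorSlot, RingHom.coe_mk, MonoidHom.coe_mk, OneHom.coe_mk,
    piKronecker_mulSingle_apply]
  fun_prop

theorem tensorSlot_smul (j : κ) (c : ℂ) (A : Matrix ι ι ℂ) :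
    tensorSlot j (c • A) = c • tensorSlot j A := by
  ext a b; simp [tensorSlot, piKronecker_mulSingle_apply, mul_assoc]

theorem commute_tensorSlot {i j : κ} (h : i ≠ j) (A B : Matrix ι ι ℂ) :
    Commute (tensorSlot i A) (tensorSlot j B) :=
  (Pi.mulSingle_commute (f := fun _ : κ => Matrix ι ι ℂ) h A B).map piKronecker

/-- The derivation `∑ 1 ⊗ ⋯ ⊗ A ⊗ ⋯ ⊗ 1` of the tensor power. -/
def tensorDerivation : Matrix ι ι ℂ →ₗ[ℂ] Matrix (κ → ι) (κ → ι) ℂ where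
  toFun A := ∑ j, tensorSlot j A
  map_add' A B := by simp [Finset.sum_add_distrib]
  map_smul' c A := by simp [tensorSlot_smul, Finset.smul_sum]

theorem tensorDerivation_apply (A : Matrix ι ι ℂ) :
    tensorDerivation (κ := κ) A = ∑ j, tensorSlot j A := rfl

/-- Different slots commute, so only the diagonal terms of the double sum survive. This makes the
tensor power a representation of the Lie algebra. -/
theorem tensorDerivation_commutator (A B : Matrix ι ι ℂ) :
    tensorDerivation (κ := κ) (A * B - B * A) =
      tensorDerivation A * tensorDerivation B - tensorDerivation B * tensorDerivation A := by
  simp only [tensorDerivation_apply, Finset.sum_mul_sum, map_sub, map_mul]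
  rw [Finset.sum_comm (f := fun i j : κ => tensorSlot i B * tensorSlot j A)]
  rw [← Finset.sum_sub_distrib, ← Finset.sum_sub_distrib]
  refine Finset.sum_congr rfl fun i _ => ?_
  rw [← Finset.sum_sub_distrib, Finset.sum_eq_single i]
  · intro j _ hj
    rw [(commute_tensorSlot hj B A).eq, sub_self]
  · simp

/-- The slots commute, so the exponential of their sum is the product of their exponentials. This
links the Lie algebra action on a tensor power to the group action. -/
theorem exp_tensorDerivation (A : Matrix ι ι ℂ) :
    NormedSpace.exp (tensorDerivation (κ := κ) A) = piKronecker fun _ => NormedSpace.exp A := by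
  rw [tensorDerivation_apply, Matrix.exp_sum_of_commute _ _
    fun i _ j _ h => commute_tensorSlot h A A]
  have h : ∀ j : κ, NormedSpace.exp (tensorSlot j A) =
      piKronecker (Pi.mulSingle j (NormedSpace.exp A)) :=
    fun j => (map_matrixExp (tensorSlot j) (continuous_tensorSlot j) A).symm
  simp only [h]
  conv_rhs => rw [← Finset.noncommProd_mulSingle (fun _ : κ => NormedSpace.exp A)]
  exact (Finset.map_noncommProd _ _ _ _).symm

/-- Decomposable tensors. -/
noncomputable def tensorProd : MultilinearMap ℂ (fun _ : κ => ι → ℂ) ((κ → ι) → ℂ) :=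
  MultilinearMap.pi fun a =>
    (MultilinearMap.mkPiAlgebra ℂ κ ℂ).compLinearMap fun j => LinearMap.proj (a j)

omit [Fintype ι] [DecidableEq ι] [DecidableEq κ] in
theorem tensorProd_apply (v : κ → ι → ℂ) (a : κ → ι) : tensorProd v a = ∏ j, v j (a j) := rfl

theorem piKronecker_mulVec_tensorProd (A : κ → Matrix ι ι ℂ) (v : κ → ι → ℂ) :
    (piKronecker A).mulVec (tensorProd v) = tensorProd fun j => (A j).mulVec (v j) := by
  ext a
  simp only [Matrix.mulVec, dotProduct, piKronecker_apply, tensorProd_apply, Finset.prod_univ_sum,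
    Fintype.piFinset_univ, Finset.prod_mul_distrib]

theorem tensorDerivation_mulVec_tensorProd (A : Matrix ι ι ℂ) (v : κ → ι → ℂ) :
    (tensorDerivation A).mulVec (tensorProd v) =
      ∑ j, tensorProd (Function.update v j (A.mulVec (v j))) := by
  rw [tensorDerivation_apply, Matrix.sum_mulVec]
  refine Finset.sum_congr rfl fun j _ => ?_
  refine (piKronecker_mulVec_tensorProd _ _).trans (congrArg _ (funext fun l => ?_))
  by_cases h : l = j
  · subst h; simp
  · simp [h]

/-- The wedge product of a family of vectors, as an antisymmetric tensor. -/
noncomputable def wedge : (ι → ℂ) [⋀^κ]→ₗ[ℂ] ((κ → ι) → ℂ) := MultilinearMap.alternatization tensorProd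

omit [Fintype ι] [DecidableEq ι] in
theorem wedge_apply (v : κ → ι → ℂ) :
    wedge v = ∑ σ : Equiv.Perm κ, Equiv.Perm.sign σ • tensorProd (v ∘ σ) :=
  MultilinearMap.alternatization_apply _ _

theorem piKronecker_mulVec_wedge (A : Matrix ι ι ℂ) (v : κ → ι → ℂ) :
    (piKronecker fun _ : κ => A).mulVec (wedge v) = wedge fun j => A.mulVec (v j) := by
  simp only [wedge_apply, Matrix.mulVec_sum]
  refine Finset.sum_congr rfl fun σ _ => ?_
  rw [Matrix.mulVec_smul, piKronecker_mulVec_tensorProd]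
  rfl

theorem tensorDerivation_mulVec_wedge (A : Matrix ι ι ℂ) (v : κ → ι → ℂ) :
    (tensorDerivation A).mulVec (wedge v) =
      ∑ j, wedge (Function.update v j (A.mulVec (v j))) := by
  simp only [wedge_apply, Matrix.mulVec_sum]
  rw [Finset.sum_comm]
  refine Finset.sum_congr rfl fun σ _ => ?_
  rw [Matrix.mulVec_smul, tensorDerivation_mulVec_tensorProd, ← Finset.smul_sum]
  congr 1
  refine Fintype.sum_equiv σ _ _ fun j => congrArg _ (funext fun l => ?_)
  by_cases h : l = j
  · subst h; simp
  · simp [h]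

theorem wedge_ne_zero {v : κ → ι → ℂ} (h : LinearIndependent ℂ v) : wedge v ≠ 0 := by
  obtain ⟨g, hg⟩ := (Fintype.linearCombination ℂ v).exists_leftInverse_of_injective
    (LinearMap.ker_eq_bot.mpr (linearIndependent_iff_injective_fintypeLinearCombination.mp h))
  -- The rows of a left inverse form a family dual to `v`; in the pairing of its tensor product with
  -- the wedge only the identity permutation contributes.
  let f : κ → ι → ℂ := fun j a => g (Pi.single a 1) j
  have hf : ∀ l j, f j ⬝ᵥ v l = if l = j then 1 else 0 := fun l j => by
    have h1 := LinearMap.congr_fun hg (Pi.single l 1)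
    rw [LinearMap.comp_apply, Fintype.linearCombination_apply_single, one_smul,
      LinearMap.id_apply] at h1
    have h2 := congrFun h1 j
    rw [pi_eq_sum_univ' (v l), map_sum] at h2
    simp only [map_smul, Finset.sum_apply, Pi.smul_apply, smul_eq_mul, Pi.single_apply] at h2
    simp only [f, dotProduct, mul_comm (g _ j), h2, eq_comm]
  have hdot : ∀ w : κ → ι → ℂ, tensorProd f ⬝ᵥ tensorProd w = ∏ j, f j ⬝ᵥ w j := fun w => by
    simp only [dotProduct, tensorProd_apply, Finset.prod_univ_sum, Fintype.piFinset_univ,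
      Finset.prod_mul_distrib]
  intro h0
  have h1 : tensorProd f ⬝ᵥ wedge v = 1 := by
    rw [wedge_apply, dotProduct_sum, Finset.sum_eq_single 1]
    · simp [hdot, hf]
    · intro σ _ hσ
      obtain ⟨j, hj⟩ : ∃ j, σ j ≠ j := by
        by_contra! hc
        exact hσ (Equiv.ext hc)
      rw [dotProduct_smul, hdot, Finset.prod_eq_zero (Finset.mem_univ j), smul_zero]
      simp [hf, hj]
    · simp
  rw [h0] at h1
  simp at h1

end TensorPower

end RealFormTheory

/-! ### The adjoint group -/

namespace RealFormTheory

section AdjointGroupLemmas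

variable {L : Type*} [LieRing L] [LieAlgebra ℂ L] [FiniteDimensional ℂ L]

/-- The matrix of `ad y` in the basis that `IsExpAd` uses. -/
noncomputable def adMatrix :
    L →ₗ[ℂ] Matrix (Fin (finrank ℂ L)) (Fin (finrank ℂ L)) ℂ where
  toFun y := LinearMap.toMatrix (finBasis ℂ L) (finBasis ℂ L) (ad ℂ L y)
  map_add' x y := by rw [map_add, map_add]
  map_smul' c x := by rw [map_smul, map_smul, RingHom.id_apply]

theorem adMatrix_apply (y : L) :
    adMatrix y = LinearMap.toMatrix (finBasis ℂ L) (finBasis ℂ L) (ad ℂ L y) := rfl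

theorem adMatrix_lie (x y : L) :
    adMatrix ⁅x, y⁆ = adMatrix x * adMatrix y - adMatrix y * adMatrix x := by
  simp only [adMatrix_apply]
  rw [← LinearMap.toMatrix_mul, ← LinearMap.toMatrix_mul, ← map_sub]
  congr 1
  ext z
  simp

theorem adMatrix_mulVec (y x : L) :
    (adMatrix y).mulVec ((finBasis ℂ L).equivFun x) = (finBasis ℂ L).equivFun ⁅y, x⁆ :=
  LinearMap.toMatrix_mulVec_repr (finBasis ℂ L) (finBasis ℂ L) (ad ℂ L y) x

theorem adMatrix_mulVec' (y : L) (v : Fin (finrank ℂ L) → ℂ) :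
    (finBasis ℂ L).equivFun.symm ((adMatrix y).mulVec v) =
      ⁅y, (finBasis ℂ L).equivFun.symm v⁆ := by
  rw [LinearEquiv.symm_apply_eq, ← adMatrix_mulVec, LinearEquiv.apply_symm_apply]

theorem exists_isExpAd (y : L) : ∃ e, IsExpAd L y e := by
  have h1 : NormedSpace.exp (adMatrix y) * NormedSpace.exp (-adMatrix y) = 1 := by
    rw [← Matrix.exp_add_of_commute _ _ ((Commute.refl (adMatrix y)).neg_right), add_neg_cancel,
      NormedSpace.exp_zero]
  have h2 : NormedSpace.exp (-adMatrix y) * NormedSpace.exp (adMatrix y) = 1 := by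
    rw [← Matrix.exp_add_of_commute _ _ (Commute.refl (adMatrix y)).neg_left, neg_add_cancel,
      NormedSpace.exp_zero]
  let b := finBasis ℂ L
  refine ⟨LinearEquiv.ofLinearMap (Matrix.toLin b b (NormedSpace.exp (adMatrix y)))
    (Matrix.toLin b b (NormedSpace.exp (-adMatrix y))) ?_ ?_, ?_⟩
  · rw [← Matrix.toLin_mul, h1, Matrix.toLin_one]
  · rw [← Matrix.toLin_mul, h2, Matrix.toLin_one]
  · have : ((LinearEquiv.ofLinearMap (Matrix.toLin b b (NormedSpace.exp (adMatrix y)))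
      (Matrix.toLin b b (NormedSpace.exp (-adMatrix y)))
      (by rw [← Matrix.toLin_mul, h1, Matrix.toLin_one])
      (by rw [← Matrix.toLin_mul, h2, Matrix.toLin_one]) : L ≃ₗ[ℂ] L) : L →ₗ[ℂ] L) =
      Matrix.toLin b b (NormedSpace.exp (adMatrix y)) := rfl
    rw [IsExpAd, this, LinearMap.toMatrix_toLin]
    rfl

/-! ### Exponentials of inner derivations -/

namespace IsExpAd

variable {y : L} {e : L ≃ₗ[ℂ] L}

theorem mem_adjointGroup (h : IsExpAd L y e) : e ∈ adjointGroup L :=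
  Subgroup.subset_closure ⟨y, h⟩

theorem equivFun_apply (h : IsExpAd L y e) (x : L) :
    (finBasis ℂ L).equivFun (e x) =
      (NormedSpace.exp (adMatrix y)).mulVec ((finBasis ℂ L).equivFun x) := by
  rw [adMatrix_apply, ← h]
  exact (LinearMap.toMatrix_mulVec_repr (finBasis ℂ L) (finBasis ℂ L) (e : L →ₗ[ℂ] L) x).symm

theorem apply_of_eigen (h : IsExpAd L y e) {x : L} {c : ℂ} (hx : ⁅y, x⁆ = c • x) :
    e x = Complex.exp c • x := by
  apply (finBasis ℂ L).equivFun.injective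
  rw [h.equivFun_apply, matrixExp_mulVec_of_eigen (c := c), map_smul]
  rw [adMatrix_mulVec, hx, map_smul]

theorem apply_of_cube (h : IsExpAd L y e) {x : L} (hx : ⁅y, ⁅y, ⁅y, x⁆⁆⁆ = 0) :
    e x = x + ⁅y, x⁆ + (2⁻¹ : ℂ) • ⁅y, ⁅y, x⁆⁆ := by
  apply (finBasis ℂ L).equivFun.injective
  rw [h.equivFun_apply, matrixExp_mulVec_of_cube]
  · simp only [adMatrix_mulVec, map_add, map_smul]
  · simp only [adMatrix_mulVec, hx, map_zero]

/-- With y a multiple of a root vector, this shows that representatives of reflections commute with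
maps that commute with `ad E_α` and `ad E_{-α}`. -/
theorem map_comm (h : IsExpAd L y e) {φ : L →ₗ[ℂ] L} (hφ : ∀ x, φ ⁅y, x⁆ = ⁅y, φ x⁆) (x : L) :
    φ (e x) = e (φ x) := by
  let E := (finBasis ℂ L).equivFun
  have h1 := matrixExp_intertwine (adMatrix y) (adMatrix y)
    (E.toLinearMap ∘ₗ φ ∘ₗ E.symm.toLinearMap) (fun u => by
      simp only [LinearMap.comp_apply, LinearEquiv.coe_coe, E, adMatrix_mulVec', hφ,
        adMatrix_mulVec]) (E x)
  rw [← h.equivFun_apply] at h1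
  simp only [LinearMap.comp_apply, LinearEquiv.coe_coe, E, LinearEquiv.symm_apply_apply] at h1
  rw [← h.equivFun_apply] at h1
  exact E.injective h1

theorem piKronecker_eq {κ : Type*} [Fintype κ] [DecidableEq κ] (h : IsExpAd L y e) :
    (piKronecker fun _ : κ =>
      LinearMap.toMatrix (finBasis ℂ L) (finBasis ℂ L) (e : L →ₗ[ℂ] L)) =
      NormedSpace.exp (tensorDerivation (adMatrix y)) := by
  rw [exp_tensorDerivation, adMatrix_apply, ← h]

/-- By the Jacobi identity the bracket intertwines the derivation that `ad y` induces on the tensor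
square with `ad y` itself. Hence it intertwines the exponentials, which are e ⊗ e and e. -/
theorem map_lie (h : IsExpAd L y e) (x z : L) : e ⁅x, z⁆ = ⁅e x, e z⁆ := by
  let b := finBasis ℂ L
  let E := b.equivFun
  let f : ((Fin 2 → Fin (finrank ℂ L)) → ℂ) →ₗ[ℂ] (Fin (finrank ℂ L) → ℂ) :=
    Fintype.linearCombination ℂ fun a => E ⁅b (a 0), b (a 1)⁆
  have hf : ∀ v, f (tensorProd v) = E ⁅E.symm (v 0), E.symm (v 1)⁆ := fun v => by
    simp only [f, Fintype.linearCombination_apply, tensorProd_apply, Fin.prod_univ_two, E,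
      Basis.equivFun_symm_apply, sum_lie, lie_sum, smul_lie, lie_smul, map_sum, map_smul]
    rw [← (finTwoArrowEquiv _).symm.sum_comp, Fintype.sum_prod_type, Finset.sum_comm]
    simp only [finTwoArrowEquiv_symm_apply, Matrix.cons_val_zero, Matrix.cons_val_one,
      Finset.smul_sum, smul_smul, mul_comm]
  have hD : ∀ v : Fin 2 → Fin (finrank ℂ L) → ℂ,
      f ((tensorDerivation (adMatrix y)).mulVec (tensorProd v)) =
        (adMatrix y).mulVec (f (tensorProd v)) := fun v => by
    rw [tensorDerivation_mulVec_tensorProd, map_sum, Fin.sum_univ_two, hf, hf, hf]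
    simp only [E, b, adMatrix_mulVec, Function.update_self, ne_eq, zero_ne_one, one_ne_zero,
      not_false_eq_true, Function.update_of_ne, adMatrix_mulVec']
    rw [← map_add, leibniz_lie y]
  -- Both sides are linear in `u`, and tensor products of standard basis vectors span.
  have hcomm : ∀ u, f ((tensorDerivation (adMatrix y)).mulVec u) = (adMatrix y).mulVec (f u) := by
    intro u
    have hu : u = ∑ a, u a • tensorProd (fun j => Pi.single (a j) (1 : ℂ)) := by
      conv_lhs => rw [pi_eq_sum_univ' u]
      refine Finset.sum_congr rfl fun a _ => ?_
      congr 1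
      ext c
      simp only [tensorProd_apply, Pi.single_apply]
      by_cases hc : c = a
      · simp [hc]
      · obtain ⟨j, hj⟩ := Function.ne_iff.mp hc
        rw [if_neg hc, Finset.prod_eq_zero (Finset.mem_univ j) (if_neg hj)]
    rw [hu]
    simp only [Matrix.mulVec_sum, Matrix.mulVec_smul, map_sum, map_smul, hD]
  have h1 := matrixExp_intertwine _ _ f hcomm (tensorProd ![E x, E z])
  have h2 : ∀ x, (LinearMap.toMatrix (finBasis ℂ L) (finBasis ℂ L) (e : L →ₗ[ℂ] L)).mulVec (E x) =
      E (e x) := fun x =>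
    LinearMap.toMatrix_mulVec_repr (finBasis ℂ L) (finBasis ℂ L) (e : L →ₗ[ℂ] L) x
  rw [← h.piKronecker_eq, piKronecker_mulVec_tensorProd, hf, hf] at h1
  simp only [Matrix.cons_val_zero, Matrix.cons_val_one, h2, LinearEquiv.symm_apply_apply] at h1
  exact (E.injective (h1.trans (h.equivFun_apply _).symm)).symm

end IsExpAd

theorem adjointGroup_map_lie {g : L ≃ₗ[ℂ] L} (hg : g ∈ adjointGroup L) (x y : L) :
    g ⁅x, y⁆ = ⁅g x, g y⁆ := by
  induction hg using Subgroup.closure_induction generalizing x y with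
  | mem g hg => obtain ⟨z, hz⟩ := hg; exact hz.map_lie x y
  | one => rfl
  | mul g g' _ _ h h' => simp only [LinearEquiv.mul_apply, h, h']
  | inv g _ h =>
    apply g.injective
    rw [h]
    simp only [← LinearEquiv.mul_apply, mul_inv_cancel, LinearEquiv.coe_one, id]

/-- Subspaces of a tensor power that are stable under the Lie algebra are stable under the adjoint
group. -/
theorem piKronecker_mulVec_mem_of_mem_adjointGroup {κ : Type*} [Fintype κ] [DecidableEq κ]
    (U : Submodule ℂ ((κ → Fin (finrank ℂ L)) → ℂ))
    (hU : ∀ x : L, ∀ u ∈ U, (tensorDerivation (adMatrix x)).mulVec u ∈ U)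
    {g : L ≃ₗ[ℂ] L} (hg : g ∈ adjointGroup L) {u : (κ → Fin (finrank ℂ L)) → ℂ} (hu : u ∈ U) :
    (piKronecker fun _ : κ =>
      LinearMap.toMatrix (finBasis ℂ L) (finBasis ℂ L) (g : L →ₗ[ℂ] L)).mulVec u ∈ U := by
  set K : (L ≃ₗ[ℂ] L) → Matrix (κ → Fin (finrank ℂ L)) (κ → Fin (finrank ℂ L)) ℂ := fun g =>
    piKronecker fun _ : κ => LinearMap.toMatrix (finBasis ℂ L) (finBasis ℂ L) (g : L →ₗ[ℂ] L)
    with hK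
  have hmul : ∀ g g', K (g * g') = K g * K g' := fun g g' => by
    simp only [hK, ← map_mul]
    congr 1
    funext j
    exact LinearMap.toMatrix_mul _ _ _
  have hone : K 1 = 1 := by
    rw [← map_one (piKronecker (ι := Fin (finrank ℂ L)) (κ := κ))]
    simp only [hK]
    congr 1
    funext j
    exact LinearMap.toMatrix_one _
  change (K g).mulVec u ∈ U
  -- An equivalence is needed for the induction to pass to inverses.
  suffices h : ∀ u, u ∈ U ↔ (K g).mulVec u ∈ U from (h u).mp hu
  clear hu u
  intro u
  induction hg using Subgroup.closure_induction generalizing u with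
  | mem g hg =>
    obtain ⟨z, hz⟩ := hg
    obtain ⟨e, he⟩ := exists_isExpAd (-z)
    have h1 : ∀ {z : L} {g : L ≃ₗ[ℂ] L}, IsExpAd L z g → ∀ u ∈ U, (K g).mulVec u ∈ U :=
      fun {z g} hz u hu => by
        simp only [hK, hz.piKronecker_eq]
        exact matrixExp_mulVec_mem _ U (hU z) hu
    refine ⟨h1 hz u, fun hu => ?_⟩
    have h2 := h1 he _ hu
    have h3 : K e * K g = 1 := by
      simp only [hK, hz.piKronecker_eq, he.piKronecker_eq, map_neg]
      rw [← Matrix.exp_add_of_commute _ _ ((Commute.refl (tensorDerivation (κ := κ) (adMatrix z))).neg_left), neg_add_cancel,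
        NormedSpace.exp_zero]
    rwa [Matrix.mulVec_mulVec, h3, Matrix.one_mulVec] at h2
  | one => rw [hone, Matrix.one_mulVec]
  | mul g g' _ _ h h' => rw [hmul, ← Matrix.mulVec_mulVec, ← h, ← h']
  | inv g _ h =>
    rw [h ((K g⁻¹).mulVec u), Matrix.mulVec_mulVec, ← hmul, mul_inv_cancel, hone,
      Matrix.one_mulVec]

end AdjointGroupLemmas

end RealFormTheory

/-! ### Automorphisms that preserve the Cartan subalgebra -/

namespace RealFormTheory

section RootAction

variable {L : Type*} [LieRing L] [LieAlgebra ℂ L] [FiniteDimensional ℂ L] [IsKilling ℂ L]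
variable {H : LieSubalgebra ℂ L} [H.IsCartanSubalgebra]

theorem mem_rootSpace_iff {χ : H → ℂ} {x : L} :
    x ∈ rootSpace H χ ↔ ∀ h : H, ⁅(h : L), x⁆ = χ h • x :=
  ⟨fun hx h => lie_eq_smul_of_mem_rootSpace hx h, fun hx =>
    LieModule.weightSpace_le_genWeightSpace L χ ((LieModule.mem_weightSpace χ x).mpr hx)⟩

theorem WeylBasis.E_ne_zero (X : WeylBasis H) (α : H.root) : X.E α ≠ 0 := fun h => by
  have := X.lie_E_neg α
  rw [h, zero_lie] at this
  exact WeylBasis.rootVec_ne_zero α (by simpa using this.symm)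

theorem WeylBasis.exists_eq_smul (X : WeylBasis H) {α : H.root} {x : L}
    (hx : x ∈ rootSpace H α.1) : ∃ c : ℂ, x = c • X.E α := by
  have h1 := finrank_rootSpace_eq_one α.1 (H.isNonZero_coe_root α)
  obtain ⟨c, hc⟩ := (finrank_eq_one_iff_of_nonzero' (K := ℂ)
    (⟨X.E α, X.E_mem α⟩ : rootSpace H α.1) (by simpa using X.E_ne_zero α)).mp h1 ⟨x, hx⟩
  exact ⟨c, by simpa using (congrArg Subtype.val hc).symm⟩

theorem root_ext {α β : H.root} (h : ∀ t : H, α.1 t = β.1 t) : α = β := by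
  ext1; ext1 t; exact h t

theorem root_root_apply (α : H.root) (h : H) : (rootSystem H).root α h = α.1 h := rfl

theorem negRoot_apply (α : H.root) (h : H) : (negRoot α).1 h = -α.1 h := rfl

/-- The linear automorphism `n` of `L` preserves `H` and acts on the roots by the permutation
`f`. -/
def ActsOnRoots (n : L ≃ₗ[ℂ] L) (f : Equiv.Perm H.root) : Prop :=
  ∃ hn : ∀ h : H, n h ∈ H, ∀ (α : H.root) (h : H), (f α).1 ⟨n h, hn h⟩ = α.1 h

theorem represents_iff_actsOnRoots {n : L ≃ₗ[ℂ] L} {w : (rootSystem H).Aut} :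
    Represents n w ↔ ActsOnRoots n w.indexEquiv := Iff.rfl

theorem exists_mem_eq_apply {n : L ≃ₗ[ℂ] L} (hn : ∀ h : H, n h ∈ H) (h : H) :
    ∃ t : H, n t = h := by
  let nH : H →ₗ[ℂ] H :=
    { toFun := fun h => ⟨n h, hn h⟩
      map_add' := fun x y => by ext; simp
      map_smul' := fun c x => by ext; simp }
  have hinj : Function.Injective nH := fun x y hxy => by
    ext
    exact n.injective (congrArg Subtype.val hxy)
  obtain ⟨t, ht⟩ := LinearMap.surjective_of_injective hinj h
  exact ⟨t, congrArg Subtype.val ht⟩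

/-- An automorphism carries a root vector of weight α to one of weight α ∘ n⁻¹, so this is again a
root. -/
theorem exists_actsOnRoots {n : L ≃ₗ[ℂ] L} (hlie : ∀ x y, n ⁅x, y⁆ = ⁅n x, n y⁆)
    (hn : ∀ h : H, n h ∈ H) : ∃ f : Equiv.Perm H.root, ActsOnRoots n f := by
  have key : ∀ α : H.root, ∃ β : H.root, ∀ h : H, β.1 ⟨n h, hn h⟩ = α.1 h := fun α => by
    choose g hg using exists_mem_eq_apply hn
    obtain ⟨e, he, he0⟩ := α.1.exists_ne_zero
    have hgn : ∀ h : H, g ⟨n h, hn h⟩ = h := fun h => by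
      ext
      exact n.injective (hg _)
    have hmem : n e ∈ rootSpace H (fun h : H => α.1 (g h)) := mem_rootSpace_iff.mpr fun h => by
      rw [← hg h, ← hlie, mem_rootSpace_iff.mp he, map_smul]
    let χ : LieModule.Weight ℂ H L := ⟨fun h : H => α.1 (g h), fun hbot => by
      have h0 : n e ∈ (⊥ : LieSubmodule ℂ H L) := hbot ▸ hmem
      exact he0 (n.map_eq_zero_iff.mp ((LieSubmodule.mem_bot _).mp h0))⟩
    have hχ : χ.IsNonZero := fun h0 => H.isNonZero_coe_root α <| by
      funext t
      have := congrFun h0 ⟨n t, hn t⟩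
      exact (congrArg α.1 (hgn t)).symm.trans this
    exact ⟨⟨χ, by simpa using hχ⟩, fun h => congrArg α.1 (hgn h)⟩
  choose f hf using key
  have hinj : Function.Injective f := fun α β hαβ => root_ext fun t => by
    rw [← hf α, ← hf β, hαβ]
  exact ⟨Equiv.ofBijective f (Finite.injective_iff_bijective.mp hinj), hn, hf⟩

namespace ActsOnRoots

variable {n m : L ≃ₗ[ℂ] L} {f g : Equiv.Perm H.root}

theorem unique (hf : ActsOnRoots n f) (hg : ActsOnRoots n g) : f = g := by
  ext1 α
  refine root_ext fun t => ?_
  obtain ⟨hn, hf⟩ := hf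
  obtain ⟨_, hg⟩ := hg
  obtain ⟨s, hs⟩ := exists_mem_eq_apply hn t
  have : t = ⟨n s, hn s⟩ := Subtype.ext hs.symm
  rw [this, hf, hg]

theorem one : ActsOnRoots (1 : L ≃ₗ[ℂ] L) (1 : Equiv.Perm H.root) :=
  ⟨fun h => h.2, fun _ _ => rfl⟩

theorem mul (hf : ActsOnRoots n f) (hg : ActsOnRoots m g) : ActsOnRoots (n * m) (f * g) := by
  obtain ⟨hn, hf⟩ := hf
  obtain ⟨hm, hg⟩ := hg
  refine ⟨fun h => hn ⟨m h, hm h⟩, fun α h => ?_⟩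
  exact (hf (g α) ⟨m h, hm h⟩).trans (hg α h)

theorem inv (hf : ActsOnRoots n f) : ActsOnRoots n⁻¹ f⁻¹ := by
  obtain ⟨hn, hf⟩ := hf
  have h1 : ∀ h : H, n⁻¹ (h : L) ∈ H := fun h => by
    obtain ⟨t, ht⟩ := exists_mem_eq_apply hn h
    rw [← ht, ← LinearEquiv.mul_apply, inv_mul_cancel]
    exact t.2
  refine ⟨h1, fun α h => ?_⟩
  rw [← hf]
  have h2 : (⟨n (n⁻¹ (h : L)), hn ⟨_, h1 h⟩⟩ : H) = h := Subtype.ext <| by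
    change (n * n⁻¹) (h : L) = h
    rw [mul_inv_cancel]
    rfl
  rw [h2]
  exact congrArg (fun β : H.root => β.1 h) (f.apply_symm_apply α)

theorem map_add (hf : ActsOnRoots n f) {α β γ : H.root}
    (h : (rootSystem H).root γ = (rootSystem H).root α + (rootSystem H).root β) :
    (rootSystem H).root (f γ) = (rootSystem H).root (f α) + (rootSystem H).root (f β) := by
  obtain ⟨hn, hf⟩ := hf
  ext t
  obtain ⟨s, hs⟩ := exists_mem_eq_apply hn t
  have : t = ⟨n s, hn s⟩ := Subtype.ext hs.symm
  have h1 := LinearMap.congr_fun h s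
  simp only [LinearMap.add_apply, root_root_apply, this, hf] at h1 ⊢
  exact h1

theorem map_neg (hf : ActsOnRoots n f) (α : H.root) : f (negRoot α) = negRoot (f α) := by
  obtain ⟨hn, hf⟩ := hf
  refine root_ext fun t => ?_
  obtain ⟨s, hs⟩ := exists_mem_eq_apply hn t
  have : t = ⟨n s, hn s⟩ := Subtype.ext hs.symm
  rw [this, hf, negRoot_apply, negRoot_apply, hf]

theorem apply_mem_rootSpace (hlie : ∀ x y, n ⁅x, y⁆ = ⁅n x, n y⁆) (hf : ActsOnRoots n f)
    {α : H.root} {x : L} (hx : x ∈ rootSpace H α.1) : n x ∈ rootSpace H (f α).1 := by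
  obtain ⟨hn, hf⟩ := hf
  refine mem_rootSpace_iff.mpr fun t => ?_
  obtain ⟨s, hs⟩ := exists_mem_eq_apply hn t
  have : t = ⟨n s, hn s⟩ := Subtype.ext hs.symm
  rw [this, hf]
  change ⁅n s, n x⁆ = _
  rw [← hlie, mem_rootSpace_iff.mp hx, map_smul]

theorem eq_of_apply_mem_rootSpace (hlie : ∀ x y, n ⁅x, y⁆ = ⁅n x, n y⁆) (hf : ActsOnRoots n f)
    {α β : H.root} {x : L} (hx : x ∈ rootSpace H α.1) (hx0 : x ≠ 0)
    (hnx : n x ∈ rootSpace H β.1) : f α = β := by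
  refine root_ext fun t => ?_
  have h1 := mem_rootSpace_iff.mp (hf.apply_mem_rootSpace hlie hx) t
  rw [mem_rootSpace_iff.mp hnx t] at h1
  exact (smul_left_injective ℂ (n.map_ne_zero_iff.mpr hx0) h1).symm

/-- Automorphisms preserve the Killing form, which defines H_α. -/
theorem apply_rootVec (hlie : ∀ x y, n ⁅x, y⁆ = ⁅n x, n y⁆) (hf : ActsOnRoots n f)
    (α : H.root) : n (rootVec α : L) = (rootVec (f α) : L) := by
  obtain ⟨hn, hf⟩ := hf
  let e : L ≃ₗ⁅ℂ⁆ L := { n with map_lie' := hlie _ _ }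
  suffices h : (⟨n (rootVec α : L), hn _⟩ : H) = rootVec (f α) from congrArg Subtype.val h
  apply (cartanEquivDual H).injective
  ext t
  obtain ⟨s, hs⟩ := exists_mem_eq_apply hn t
  have : t = ⟨n s, hn s⟩ := Subtype.ext hs.symm
  have h1 : killingForm ℂ L (n (rootVec α : L)) (n s) = killingForm ℂ L (rootVec α : L) s :=
    killingForm_of_equiv_apply e _ _
  have h2 := WeylBasis.rootVec_form (f α) t
  have h3 := WeylBasis.rootVec_form α s
  rw [this, hf] at h2
  rw [this]
  exact (h1.trans h3).trans h2.symm

end ActsOnRoots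

end RootAction

end RealFormTheory

namespace RealFormTheory

/-! ### Positive roots -/

section Positive

variable {L : Type*} [LieRing L] [LieAlgebra ℂ L] [FiniteDimensional ℂ L] [IsKilling ℂ L]
variable {H : LieSubalgebra ℂ L} [H.IsCartanSubalgebra] {b : (rootSystem H).Base}

theorem reflectionPerm_self (α : H.root) : (rootSystem H).reflectionPerm α α = negRoot α := by
  apply (rootSystem H).root.injective
  rw [(rootSystem H).root_reflectionPerm, (rootSystem H).reflection_apply_self]
  rfl

theorem height_negRoot (α : H.root) : b.height (negRoot α) = -b.height α := by
  have h := b.height_reflectionPerm_self α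
  rwa [← reflectionPerm_self]

theorem isPos_negRoot_iff {α : H.root} : b.IsPos (negRoot α) ↔ ¬ b.IsPos α := by
  rw [RootPairing.Base.isPos_iff, RootPairing.Base.isPos_iff, height_negRoot]
  have := b.height_ne_zero α
  omega

theorem one_le_height {α : H.root} (h : b.IsPos α) : 1 ≤ b.height α := h

theorem exists_forall_simple_apply_eq (b : (rootSystem H).Base) (c : b.support → ℂ) :
    ∃ h : H, ∀ i : b.support, (i : H.root).1 h = c i := by
  refine ⟨(evalEquiv ℂ H).symm (b.toWeightBasis.constr ℂ c), fun i => ?_⟩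
  have h1 := b.toWeightBasis.constr_basis ℂ c i
  rw [b.toWeightBasis_apply] at h1
  rw [← h1, ← root_root_apply]
  exact apply_evalEquiv_symm_apply ..

theorem exists_eq_sum_nat_of_isPos {α : H.root} (h : b.IsPos α) :
    ∃ n : H.root → ℕ, ∀ t : H, α.1 t = ∑ i ∈ b.support, (n i : ℂ) * i.1 t := by
  obtain ⟨n, -, hn | hn⟩ := b.exists_root_eq_sum_nat_or_neg α
  · refine ⟨n, fun t => ?_⟩
    rw [← root_root_apply, hn]
    simp [LinearMap.sum_apply]
  · exfalso
    have h1 : (rootSystem H).root α =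
        ∑ j ∈ b.support, (fun j => -(n j : ℤ)) j • (rootSystem H).root j := by
      rw [hn, ← Finset.sum_neg_distrib]
      exact Finset.sum_congr rfl fun j _ => by simp
    have h2 := one_le_height h
    rw [RootPairing.Base.height_eq_sum h1] at h2
    have h3 : ∑ j ∈ b.support, -(n j : ℤ) ≤ 0 := Finset.sum_nonpos fun j _ => by simp
    omega

theorem mem_support_or_exists_eq_add_of_isPos {α : H.root} (h : b.IsPos α) :
    α ∈ b.support ∨ ∃ β γ, b.IsPos β ∧ b.IsPos γ ∧
      (rootSystem H).root α = (rootSystem H).root β + (rootSystem H).root γ := by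
  -- Positivity is carried along because the induction step needs it for the smaller root.
  suffices b.IsPos α ∧ (α ∈ b.support ∨ ∃ β γ, b.IsPos β ∧ b.IsPos γ ∧
      (rootSystem H).root α = (rootSystem H).root β + (rootSystem H).root γ) from this.2
  refine h.induction_on_add (p := fun α => b.IsPos α ∧ (α ∈ b.support ∨ ∃ β γ, b.IsPos β ∧
      b.IsPos γ ∧ (rootSystem H).root α = (rootSystem H).root β + (rootSystem H).root γ))
    (fun i hi => ⟨b.isPos_of_mem_support hi, Or.inl hi⟩) ?_
  rintro i j k hk ⟨hi, -⟩ hj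
  have hj' := b.isPos_of_mem_support hj
  exact ⟨hi.add hj' hk, Or.inr ⟨i, j, hi, hj', hk⟩⟩

theorem ActsOnRoots.isPos_of_isPos_apply {n : L ≃ₗ[ℂ] L} {f : Equiv.Perm H.root}
    (hf : ActsOnRoots n f) (hpos : ∀ α, b.IsPos α → b.IsPos (f α)) {α : H.root}
    (h : b.IsPos (f α)) : b.IsPos α := by
  by_contra hα
  have h1 := hpos _ (isPos_negRoot_iff.mpr hα)
  rw [hf.map_neg] at h1
  exact isPos_negRoot_iff.mp h1 h

/-- If `f i` were a sum of two positive roots, then `f⁻¹` would split `i` in the same way, giving it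
height at least 2. -/
theorem ActsOnRoots.apply_mem_support {n : L ≃ₗ[ℂ] L} {f : Equiv.Perm H.root}
    (hf : ActsOnRoots n f) (hpos : ∀ α, b.IsPos α → b.IsPos (f α)) {i : H.root}
    (hi : i ∈ b.support) : f i ∈ b.support := by
  have h1 := hpos i (b.isPos_of_mem_support hi)
  rcases mem_support_or_exists_eq_add_of_isPos h1 with h | ⟨β, γ, hβ, hγ, h⟩
  · exact h
  · exfalso
    have h2 := hf.inv.map_add h
    have h3 : ∀ α, b.IsPos α → b.IsPos (f⁻¹ α) := fun α hα =>
      hf.isPos_of_isPos_apply hpos ((f.apply_symm_apply α).symm ▸ hα)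
    have h4 : f⁻¹ (f i) = i := f.symm_apply_apply i
    have h5 := b.height_add h2
    rw [h4, b.height_one_of_mem_support hi] at h5
    have := one_le_height (h3 β hβ)
    have := one_le_height (h3 γ hγ)
    omega

theorem lie_eq_zero_or_exists_root {α β : H.root} (hα : b.IsPos α) (hβ : b.IsPos β) {x y : L}
    (hx : x ∈ rootSpace H α.1) (hy : y ∈ rootSpace H β.1) :
    ⁅x, y⁆ = 0 ∨ ∃ γ : H.root, ⁅x, y⁆ ∈ rootSpace H γ.1 ∧
      (rootSystem H).root γ = (rootSystem H).root α + (rootSystem H).root β := by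
  by_cases h : ⁅x, y⁆ = 0
  · exact Or.inl h
  right
  have hmem : ⁅x, y⁆ ∈ rootSpace H (α.1 + β.1 : H → ℂ) :=
    lie_mem_genWeightSpace_of_mem_genWeightSpace hx hy
  let χ : LieModule.Weight ℂ H L := ⟨(α.1 + β.1 : H → ℂ), fun hbot => by
    have h0 : ⁅x, y⁆ ∈ (⊥ : LieSubmodule ℂ H L) := hbot ▸ hmem
    exact h ((LieSubmodule.mem_bot _).mp h0)⟩
  have hχ : χ.IsNonZero := fun h0 => by
    have h1 : α = negRoot β := root_ext fun t => by
      have h2 := congrFun h0 t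
      have h3 : α.1 t + β.1 t = 0 := h2
      rw [negRoot_apply]
      linear_combination h3
    rw [h1] at hα
    exact isPos_negRoot_iff.mp hα hβ
  exact ⟨⟨χ, by simpa using hχ⟩, hmem, by ext t; rfl⟩

end Positive

/-! ### Elements of the adjoint group that preserve the positive roots -/

section HighestWeight

variable {L : Type*} [LieRing L] [LieAlgebra ℂ L] [FiniteDimensional ℂ L] [IsKilling ℂ L]
variable {H : LieSubalgebra ℂ L} [H.IsCartanSubalgebra] {b : (rootSystem H).Base}

/-- The submodule generated by a highest weight vector `v`: the eigenvalues of `h₀` on it differ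
from the one of `v` by natural numbers, if all positive roots take such values on `h₀`. -/
theorem exists_submodule_of_highestWeight (X : WeylBasis H) {V : Type*} [AddCommGroup V]
    [Module ℂ V] (ρ : L →ₗ[ℂ] End ℂ V) (hρ : ∀ x y u, ρ ⁅x, y⁆ u = ρ x (ρ y u) - ρ y (ρ x u))
    {v : V} (hvE : ∀ α, b.IsPos α → ∃ c : ℂ, ρ (X.E α) v = c • v)
    (hvH : ∀ h : H, ∃ c : ℂ, ρ h v = c • v) {h₀ : H}
    (hh₀ : ∀ α, b.IsPos α → ∃ m : ℕ, α.1 h₀ = m) {c : ℂ} (hc : ρ h₀ v = c • v) :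
    ∃ U : Submodule ℂ V, v ∈ U ∧ (∀ x, ∀ u ∈ U, ρ x u ∈ U) ∧
      U ≤ ⨆ m : ℕ, (ρ h₀).eigenspace (c - m) := by
  -- `U` will be the least subspace that contains `v` and is stable under the lowering operators
  -- E_{-α}.
  let S : Set (Submodule ℂ V) :=
    {T | v ∈ T ∧ ∀ α, b.IsPos α → ∀ u ∈ T, ρ (X.E (negRoot α)) u ∈ T}
  let U : Submodule ℂ V := sInf S
  have hvU : v ∈ U := (Submodule.mem_sInf).mpr fun T hT => hT.1
  have hneg : ∀ α, b.IsPos α → ∀ u ∈ U, ρ (X.E (negRoot α)) u ∈ U := fun α hα u hu =>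
    Submodule.mem_sInf.mpr fun T hT => hT.2 α hα u (Submodule.mem_sInf.mp hu T hT)
  refine ⟨U, hvU, ?_, ?_⟩
  -- `T` is the part of `U` that all of `L` maps into `U`. It contains `v` and is stable under
  -- lowering, hence contains `U` by minimality.
  · let T : Submodule ℂ V := U ⊓ ⨅ x, U.comap (ρ x)
    have hT : ∀ u, u ∈ T ↔ u ∈ U ∧ ∀ x, ρ x u ∈ U := fun u => by
      simp [T, Submodule.mem_iInf]
    have hUT : U ≤ T := sInf_le ⟨(hT v).mpr ⟨hvU, fun x => ?_⟩, fun α hα u hu => ?_⟩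
    · exact fun x u hu => ((hT u).mp (hUT hu)).2 x
    · rw [← X.expansion x]
      simp only [map_add, map_sum, map_smul, LinearMap.add_apply, LinearMap.sum_apply,
        LinearMap.smul_apply]
      refine U.add_mem (U.sum_mem fun α _ => U.smul_mem _ ?_)
        (U.sum_mem fun α _ => U.smul_mem _ ?_)
      · obtain ⟨a, ha⟩ := hvH (rootVec α)
        rw [ha]
        exact U.smul_mem _ hvU
      · by_cases hα : b.IsPos α
        · obtain ⟨a, ha⟩ := hvE α hα
          rw [ha]
          exact U.smul_mem _ hvU
        · have := hneg _ (isPos_negRoot_iff.mpr hα) v hvU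
          rwa [WeylBasis.negRoot_negRoot] at this
    · obtain ⟨hu, hux⟩ := (hT u).mp hu
      refine (hT _).mpr ⟨hneg α hα u hu, fun x => ?_⟩
      have h1 := hρ x (X.E (negRoot α)) u
      rw [eq_sub_iff_add_eq] at h1
      rw [← h1]
      exact U.add_mem (hux _) (hneg α hα _ (hux x))
  -- The sum of eigenspaces also contains `v` and is stable under lowering: E_{-α} lowers the
  -- eigenvalue by the natural number α(h₀).
  · refine sInf_le ⟨?_, fun α hα u hu => ?_⟩
    · refine Submodule.mem_iSup_of_mem 0 ?_
      rw [End.mem_eigenspace_iff, hc]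
      simp
    · induction hu using Submodule.iSup_induction' with
      | mem m u hu =>
        obtain ⟨k, hk⟩ := hh₀ α hα
        refine Submodule.mem_iSup_of_mem (m + k) ?_
        rw [End.mem_eigenspace_iff] at hu ⊢
        have h1 := hρ h₀ (X.E (negRoot α)) u
        rw [mem_rootSpace_iff.mp (X.E_mem (negRoot α)) h₀, negRoot_apply, hk, hu, map_smul,
          map_smul, LinearMap.smul_apply, eq_sub_iff_add_eq] at h1
        rw [← h1, ← add_smul]
        congr 1
        push_cast
        ring
      | zero => rw [map_zero]; exact zero_mem _
      | add u w _ _ hu hw => rw [map_add]; exact add_mem hu hw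

theorem WeylBasis.linearIndependent_E (X : WeylBasis H) : LinearIndependent ℂ X.E := by
  classical
  refine Fintype.linearIndependent_iff.mpr fun c hc α => ?_
  have h := congrArg (killingForm ℂ L (X.E (negRoot α))) hc
  simpa [WeylBasis.E_form_E] using h

theorem tensorDerivation_adMatrix_wedge_of_cartan {κ : Type*} [Fintype κ] [DecidableEq κ]
    (y : κ → L) (k : κ → H.root) (hy : ∀ l, y l ∈ rootSpace H (k l).1) (h : H) :
    (tensorDerivation (adMatrix (h : L))).mulVec
      (wedge fun l => (finBasis ℂ L).equivFun (y l)) =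
      (∑ l, (k l).1 h) • wedge fun l => (finBasis ℂ L).equivFun (y l) := by
  rw [tensorDerivation_mulVec_wedge, Finset.sum_smul]
  refine Finset.sum_congr rfl fun l _ => ?_
  rw [adMatrix_mulVec, mem_rootSpace_iff.mp (hy l), map_smul, AlternatingMap.map_update_smul,
    Function.update_eq_self]

/-- Bracketing a factor with E_α gives zero or a root vector of height at least 2. That root is not
the omitted simple root `i`, so its vector already occurs in the wedge as another factor. -/
theorem tensorDerivation_adMatrix_wedge_of_isPos (X : WeylBasis H) {κ : Type*} [Fintype κ]
    [DecidableEq κ] {k : κ → H.root} {i : H.root}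
    (hk : ∀ β, (∃ l, k l = β) ↔ b.IsPos β ∧ β ≠ i) (hi : i ∈ b.support) {α : H.root}
    (hα : b.IsPos α) :
    (tensorDerivation (adMatrix (X.E α))).mulVec
      (wedge fun l => (finBasis ℂ L).equivFun (X.E (k l))) = 0 := by
  rw [tensorDerivation_mulVec_wedge]
  refine Finset.sum_eq_zero fun l _ => ?_
  have hl := ((hk (k l)).mp ⟨l, rfl⟩).1
  rw [adMatrix_mulVec]
  rcases lie_eq_zero_or_exists_root hα hl (X.E_mem α) (X.E_mem (k l)) with h | ⟨γ, hγ, hadd⟩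
  · rw [h, map_zero, AlternatingMap.map_update_zero]
  · obtain ⟨c, hc⟩ := X.exists_eq_smul hγ
    have h1 := b.height_add hadd
    have h2 := one_le_height hα
    have h3 := one_le_height hl
    have hγi : γ ≠ i := by
      rintro rfl
      rw [b.height_one_of_mem_support hi] at h1
      omega
    obtain ⟨l', rfl⟩ := (hk γ).mpr ⟨hα.add hl hadd, hγi⟩
    have hne : l ≠ l' := by
      rintro rfl
      omega
    rw [hc, map_smul, AlternatingMap.map_update_smul]
    have h4 := (wedge (ι := Fin (finrank ℂ L))).map_update_self
      (fun l => (finBasis ℂ L).equivFun (X.E (k l))) hne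
    exact (congrArg (c • ·) h4).trans (smul_zero c)

/-- The wedge over positive roots other than `i` generates a submodule that `g` preserves. If `g`
moved `i`, the image of the wedge would be a nonzero vector of this submodule on which h₀ has an
eigenvalue above the highest one. -/
theorem ActsOnRoots.apply_eq_self_of_wedge (X : WeylBasis H) {κ : Type*} [Fintype κ]
    [DecidableEq κ] {k : κ → H.root} (hkinj : Function.Injective k) {i : H.root}
    (hk : ∀ β, (∃ l, k l = β) ↔ b.IsPos β ∧ β ≠ i) {g : L ≃ₗ[ℂ] L}
    (hg : g ∈ adjointGroup L) {f : Equiv.Perm H.root} (hf : ActsOnRoots g f)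
    (hpos : ∀ α, b.IsPos α → b.IsPos (f α)) (hi : i ∈ b.support) : f i = i := by
  classical
  by_contra hne
  let E := (finBasis ℂ L).equivFun
  have hfi := hf.apply_mem_support hpos hi
  -- The fundamental coweight dual to `i`: it separates `i` from `f i`, which is another simple
  -- root.
  obtain ⟨h₀, hh₀⟩ := exists_forall_simple_apply_eq b fun j => if (j : H.root) = i then 1 else 0
  have hi1 : i.1 h₀ = 1 := by simpa using hh₀ ⟨i, hi⟩
  have hfi0 : (f i).1 h₀ = 0 := by simpa [hne] using hh₀ ⟨f i, hfi⟩
  have hnat : ∀ α, b.IsPos α → ∃ m : ℕ, α.1 h₀ = m := fun α hα => by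
    obtain ⟨n, hn⟩ := exists_eq_sum_nat_of_isPos hα
    refine ⟨n i, ?_⟩
    rw [hn, Finset.sum_eq_single_of_mem i hi, hi1, mul_one]
    intro j hj hji
    have := hh₀ ⟨j, hj⟩
    simp only [hji, if_false] at this
    rw [this, mul_zero]
  let ρ : L →ₗ[ℂ] End ℂ ((κ → Fin (finrank ℂ L)) → ℂ) :=
    (Matrix.toLin' : Matrix (κ → Fin (finrank ℂ L)) (κ → Fin (finrank ℂ L)) ℂ ≃ₗ[ℂ] _).toLinearMap
      ∘ₗ tensorDerivation ∘ₗ adMatrix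
  have hρ : ∀ x u, ρ x u = (tensorDerivation (adMatrix x)).mulVec u := fun x u =>
    Matrix.toLin'_apply _ _
  let v : (κ → Fin (finrank ℂ L)) → ℂ := wedge fun l : κ => E (X.E (k l))
  have hvH : ∀ h : H, ρ h v = (∑ l : κ, (k l).1 h) • v := fun h => by
    rw [hρ]
    exact tensorDerivation_adMatrix_wedge_of_cartan (fun l : κ => X.E (k l)) k
      (fun l => X.E_mem (k l)) h
  obtain ⟨U, hvU, hU, hUle⟩ := exists_submodule_of_highestWeight (b := b) X ρ (fun x y u => by
      rw [hρ, hρ, hρ, hρ, hρ, adMatrix_lie, tensorDerivation_commutator, Matrix.sub_mulVec,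
        Matrix.mulVec_mulVec, Matrix.mulVec_mulVec]) (v := v)
    (fun α hα => ⟨0, by rw [hρ, zero_smul]; exact tensorDerivation_adMatrix_wedge_of_isPos X hk hi hα⟩)
    (fun h => ⟨_, hvH h⟩) hnat (hvH h₀)
  have hgU := piKronecker_mulVec_mem_of_mem_adjointGroup U
    (fun x u hu => hρ x u ▸ hU x u hu) hg hvU
  have hgv : (piKronecker fun _ : κ =>
      LinearMap.toMatrix (finBasis ℂ L) (finBasis ℂ L) (g : L →ₗ[ℂ] L)).mulVec v =
      wedge fun l : κ => E (g (X.E (k l))) := by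
    rw [piKronecker_mulVec_wedge]
    congr 1
    funext l
    exact LinearMap.toMatrix_mulVec_repr (finBasis ℂ L) (finBasis ℂ L) (g : L →ₗ[ℂ] L) _
  rw [hgv] at hgU
  have hlie := adjointGroup_map_lie hg
  have heig := tensorDerivation_adMatrix_wedge_of_cartan (fun l : κ => g (X.E (k l)))
    (fun l => f (k l)) (fun l => hf.apply_mem_rootSpace hlie (X.E_mem (k l))) h₀
  -- `f` permutes the positive roots, so only the omitted root matters: it was `i`, with value 1 at
  -- h₀, and becomes `f i`, with value 0.
  have hsum : ∑ l : κ, (f (k l)).1 h₀ = ∑ l : κ, (k l).1 h₀ + 1 := by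
    have himg : Finset.univ.image k = ({α | b.IsPos α} : Finset H.root).erase i := by
      ext β
      simpa [and_comm] using hk β
    have h1 : ∀ φ : H.root → ℂ, ∑ l : κ, φ (k l) = ∑ α with b.IsPos α, φ α - φ i := fun φ => by
      rw [← Finset.sum_image (f := φ) hkinj.injOn, himg,
        Finset.sum_erase_eq_sub (by simpa using b.isPos_of_mem_support hi)]
    have h2 : ∑ α with b.IsPos α, (f α).1 h₀ = ∑ α with b.IsPos α, α.1 h₀ :=
      Finset.sum_equiv f (fun α => by
        simpa using ⟨hpos α, hf.isPos_of_isPos_apply hpos⟩) fun _ _ => rfl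
    rw [h1 fun α => (f α).1 h₀, h1 fun α => α.1 h₀, h2, hi1, hfi0]
    ring
  rw [hsum] at heig
  have hmem : (wedge fun l : κ => E (g (X.E (k l)))) ∈
      (ρ h₀).eigenspace (∑ l : κ, (k l).1 h₀ + 1) := by
    rw [End.mem_eigenspace_iff, hρ]
    exact heig
  have hdisj := (End.eigenspaces_iSupIndep (ρ h₀)) (∑ l : κ, (k l).1 h₀ + 1)
  have hle : (⨆ m : ℕ, (ρ h₀).eigenspace (∑ l : κ, (k l).1 h₀ - m)) ≤
      ⨆ j, ⨆ _ : j ≠ ∑ l : κ, (k l).1 h₀ + 1, (ρ h₀).eigenspace j :=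
    iSup_le fun m => le_iSup₂_of_le (∑ l : κ, (k l).1 h₀ - m) (fun h => by
      have h1 : ((m + 1 : ℕ) : ℂ) = 0 := by push_cast; linear_combination -h
      exact Nat.succ_ne_zero m (Nat.cast_eq_zero.mp h1)) le_rfl
  have hzero := Submodule.disjoint_def.mp hdisj _ hmem (hle (hUle hgU))
  refine wedge_ne_zero (v := fun l : κ => E (g (X.E (k l)))) ?_ hzero
  have h1 : LinearIndependent ℂ fun l : κ => X.E (k l) :=
    X.linearIndependent_E.comp _ hkinj
  have h2 := (h1.map' (g : L →ₗ[ℂ] L) g.ker).map'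
    ((finBasis ℂ L).equivFun : L →ₗ[ℂ] (Fin (finrank ℂ L) → ℂ)) (LinearEquiv.ker _)
  exact h2

/-- An element of the adjoint group that preserves `H` and the positive roots acts trivially on
the simple roots. -/
theorem ActsOnRoots.apply_eq_self_of_mem_adjointGroup (X : WeylBasis H) {g : L ≃ₗ[ℂ] L}
    (hg : g ∈ adjointGroup L) {f : Equiv.Perm H.root} (hf : ActsOnRoots g f)
    (hpos : ∀ α, b.IsPos α → b.IsPos (f α)) {i : H.root} (hi : i ∈ b.support) : f i = i := by
  classical
  exact hf.apply_eq_self_of_wedge X (k := fun l : {β : H.root // b.IsPos β ∧ β ≠ i} => l.1)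
    Subtype.val_injective (fun β => by simp) hg hpos hi

end HighestWeight

end RealFormTheory

namespace RealFormTheory

/-! ### Representatives of Weyl group elements, and the torus -/

section Representatives

variable {L : Type*} [LieRing L] [LieAlgebra ℂ L] [FiniteDimensional ℂ L] [IsKilling ℂ L]
variable {H : LieSubalgebra ℂ L} [H.IsCartanSubalgebra] {b : (rootSystem H).Base}

theorem exists_coroot_eq_smul_rootVec (α : H.root) : ∃ c : ℂ, coroot α.1 = c • rootVec α := by
  refine ⟨2 * (α.1 (rootVec α))⁻¹, ?_⟩
  rw [coroot, ← Nat.cast_smul_eq_nsmul ℂ, mul_smul]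
  rfl

/-- The classical product exp(ad e) exp(-ad f) exp(ad e) for an 𝔰𝔩₂-triple through α. The
commutation clause holds because only root vectors for ±α enter the product; it later carries
information from one root vector to its reflections. -/
theorem exists_mem_adjointGroup_reflection (X : WeylBasis H) (α : H.root) :
    ∃ n ∈ adjointGroup L, (∀ h : H, n h = h - α.1 h • (coroot α.1 : L)) ∧
      ∀ φ : L →ₗ[ℂ] L, (∀ x, φ ⁅X.E α, x⁆ = ⁅X.E α, φ x⁆) →
        (∀ x, φ ⁅X.E (negRoot α), x⁆ = ⁅X.E (negRoot α), φ x⁆) → ∀ x, φ (n x) = n (φ x) := by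
  obtain ⟨c, hc⟩ := exists_coroot_eq_smul_rootVec α
  set k : H := coroot α.1 with hk
  set e := X.E α with he
  set f := X.E (negRoot α) with hf
  -- The scalar `c` rescales `f` so that `e`, the coroot `k` and `c • f` form an 𝔰𝔩₂-triple.
  have hef : ⁅c • f, e⁆ = -(k : L) := by
    rw [smul_lie, ← lie_skew, X.lie_E_neg, hc]
    simp
  have hhe : ∀ h : H, ⁅(h : L), e⁆ = α.1 h • e := mem_rootSpace_iff.mp (X.E_mem α)
  have hhf : ∀ h : H, ⁅(h : L), f⁆ = -(α.1 h • f) := fun h => by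
    rw [mem_rootSpace_iff.mp (X.E_mem (negRoot α)), negRoot_apply, neg_smul]
  have hk2 : α.1 k = 2 := root_apply_coroot (H.isNonZero_coe_root α)
  obtain ⟨e₁, he₁⟩ := exists_isExpAd e
  obtain ⟨e₂, he₂⟩ := exists_isExpAd (-(c • f))
  have heh : ∀ h : H, ⁅e, (h : L)⁆ = -(α.1 h • e) := fun h => by rw [← lie_skew, hhe]
  have hfh : ∀ h : H, ⁅-(c • f), (h : L)⁆ = -(α.1 h • c • f) := fun h => by
    rw [neg_lie, smul_lie, ← lie_skew, hhf, smul_neg, smul_neg, neg_neg, smul_comm]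
  have h1 : ∀ h : H, e₁ h = h - α.1 h • e := fun h => by
    rw [he₁.apply_of_cube] <;> simp [heh, sub_eq_add_neg]
  have h1e : e₁ e = e := by
    rw [he₁.apply_of_cube] <;> simp
  have h2 : ∀ h : H, e₂ h = h - α.1 h • c • f := fun h => by
    rw [he₂.apply_of_cube] <;> simp [hfh, sub_eq_add_neg]
  have h2e : e₂ e = e + k - c • f := by
    have h3 : ⁅-(c • f), e⁆ = k := by rw [neg_lie, hef, neg_neg]
    have h4 : ⁅-(c • f), (k : L)⁆ = -((2 : ℂ) • c • f) := by rw [hfh, hk2]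
    rw [he₂.apply_of_cube]
    · rw [h3, h4]
      module
    · rw [h3, h4]
      simp
  refine ⟨e₁ * e₂ * e₁, mul_mem (mul_mem he₁.mem_adjointGroup he₂.mem_adjointGroup)
    he₁.mem_adjointGroup, fun h => ?_, fun φ hφe hφf x => ?_⟩
  · have h5 : e₁ ((h : L) - α.1 h • (k : L)) = h - α.1 h • (k : L) + α.1 h • e := by
      rw [map_sub, map_smul, h1, h1, hk2]
      module
    change e₁ (e₂ (e₁ h)) = _
    rw [h1, map_sub, map_smul, h2, h2e]
    have h6 : (h : L) - α.1 h • c • f - α.1 h • (e + k - c • f) =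
        ((h : L) - α.1 h • (k : L)) - α.1 h • e := by module
    rw [h6, map_sub, h5, map_smul, h1e]
    module
  · change φ (e₁ (e₂ (e₁ x))) = e₁ (e₂ (e₁ (φ x)))
    have hφ2 : ∀ x, φ ⁅-(c • f), x⁆ = ⁅-(c • f), φ x⁆ := fun x => by
      simp [smul_lie, neg_lie, hφf]
    rw [he₁.map_comm hφe, he₂.map_comm hφ2, he₁.map_comm hφe]

theorem actsOnRoots_reflection {n : L ≃ₗ[ℂ] L} {α : H.root}
    (hn : ∀ h : H, n h = h - α.1 h • (coroot α.1 : L)) :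
    ActsOnRoots n ((rootSystem H).reflectionPerm α) := by
  have hn' : ∀ h : H, n h = ((h - α.1 h • coroot α.1 : H) : L) := fun h => by
    rw [hn]; simp
  refine ⟨fun h => hn' h ▸ SetLike.coe_mem _, fun β h => ?_⟩
  have h1 : (⟨n h, hn' h ▸ SetLike.coe_mem _⟩ : H) = h - α.1 h • coroot α.1 :=
    Subtype.ext (hn' h)
  rw [h1, ← root_root_apply, (rootSystem H).root_reflectionPerm,
    RootPairing.reflection_apply_root]
  have hk2 : α.1 (coroot α.1) = 2 := root_apply_coroot (H.isNonZero_coe_root α)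
  simp only [LinearMap.sub_apply, LinearMap.smul_apply, root_root_apply, map_sub, map_smul,
    smul_eq_mul, rootSystem_pairing_apply, hk2]
  ring

theorem exists_represents (X : WeylBasis H) {w : (rootSystem H).Aut}
    (hw : w ∈ (rootSystem H).weylGroup) :
    ∃ n ∈ adjointGroup L, ActsOnRoots n w.indexEquiv := by
  induction hw using RootPairing.weylGroup.induction with
  | mem α =>
    obtain ⟨n, hn, hnH, -⟩ := exists_mem_adjointGroup_reflection X α
    exact ⟨n, hn, actsOnRoots_reflection hnH⟩
  | one => exact ⟨1, one_mem _, ActsOnRoots.one⟩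
  | mul x y _ _ hx hy =>
    obtain ⟨n, hn, hnx⟩ := hx
    obtain ⟨m, hm, hmy⟩ := hy
    exact ⟨n * m, mul_mem hn hm, hnx.mul hmy⟩

/-- Elements of the torus with prescribed eigenvalues on the root spaces of the images of the
simple roots. -/
theorem exists_torus (X : WeylBasis H) {n : L ≃ₗ[ℂ] L} {f : Equiv.Perm H.root}
    (hf : ActsOnRoots n f) (c : b.support → ℂ) (hc : ∀ i, c i ≠ 0) :
    ∃ t ∈ adjointGroup L, (∀ h : H, t h = h) ∧
      ∀ i : b.support, t (X.E (f i)) = c i • X.E (f i) := by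
  obtain ⟨hn, hf⟩ := hf
  -- The torus element is exp(ad (n h₀)): the root `f i` takes at `n h₀` the value of `i` at h₀, a
  -- logarithm of `c i`.
  obtain ⟨h₀, hh₀⟩ := exists_forall_simple_apply_eq b fun i => Complex.log (c i)
  obtain ⟨t, ht⟩ := exists_isExpAd (n h₀)
  refine ⟨t, ht.mem_adjointGroup, fun h => ?_, fun i => ?_⟩
  · have h1 : ⁅n h₀, (h : L)⁆ = (0 : ℂ) • (h : L) := by
      rw [zero_smul]
      exact congrArg Subtype.val (trivial_lie_zero H H ⟨n h₀, hn h₀⟩ h)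
    rw [ht.apply_of_eigen h1]
    simp
  · rw [ht.apply_of_eigen (mem_rootSpace_iff.mp (X.E_mem (f i)) ⟨n h₀, hn h₀⟩), hf, hh₀, Complex.exp_log (hc i)]

/-- A Lie algebra automorphism is determined by its values on the `H_α` and `E_α` for simple
`α`. -/
theorem eq_self_of_fixes_simple (X : WeylBasis H) {n : L ≃ₗ[ℂ] L}
    (hlie : ∀ x y, n ⁅x, y⁆ = ⁅n x, n y⁆)
    (hH : ∀ i ∈ b.support, n (rootVec i : L) = (rootVec i : L))
    (hE : ∀ i ∈ b.support, n (X.E i) = X.E i) (x : L) : n x = x := by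
  have hnH : ∀ h : H, n h = h := fun h => by
    have h1 : (n : L →ₗ[ℂ] L) ∘ₗ H.subtype ∘ₗ (cartanEquivDual H).symm.toLinearMap =
        (H.subtype : H →ₗ[ℂ] L) ∘ₗ (cartanEquivDual H).symm.toLinearMap :=
      b.toWeightBasis.ext fun i => by
        rw [b.toWeightBasis_apply]
        exact hH i i.2
    have h2 := LinearMap.congr_fun h1 (cartanEquivDual H h)
    simpa using h2
  have hacts : ActsOnRoots n (1 : Equiv.Perm H.root) :=
    ⟨fun h => (hnH h).symm ▸ h.2, fun α h => congrArg α.1 (Subtype.ext (hnH h))⟩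
  -- A priori E_{-α} is only scaled; [E_α, E_{-α}] = H_α is fixed and nonzero, so the scalar is 1.
  have hneg : ∀ α, n (X.E α) = X.E α → n (X.E (negRoot α)) = X.E (negRoot α) := fun α hα => by
    obtain ⟨c, hc⟩ := X.exists_eq_smul (hacts.apply_mem_rootSpace hlie (X.E_mem (negRoot α)))
    have h1 := hlie (X.E α) (X.E (negRoot α))
    rw [hα, hc, X.lie_E_neg, hnH, lie_smul] at h1
    change _ = c • ⁅X.E α, X.E (negRoot α)⁆ at h1
    rw [X.lie_E_neg] at h1
    have h2 : (rootVec α : L) ≠ 0 := by simpa using WeylBasis.rootVec_ne_zero α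
    have h3 : c = 1 := smul_left_injective ℂ h2 (by simpa using h1.symm)
    rw [hc, h3, one_smul]
    rfl
  have hall : ∀ α, n (X.E α) = X.E α := fun α => by
    refine b.induction_reflect α (p := fun α => n (X.E α) = X.E α) ?_ hE ?_
    · intro α hα
      rw [reflectionPerm_self]
      exact hneg α hα
    · intro α j hα hj
      -- `n` fixes E_j and E_{-j}, so it commutes with `m`; it therefore fixes m(E_α), a nonzero
      -- multiple of the root vector of the reflected root.
      obtain ⟨m, hm, hmH, hmc⟩ := exists_mem_adjointGroup_reflection X j
      obtain ⟨c, hc⟩ := X.exists_eq_smul ((actsOnRoots_reflection hmH).apply_mem_rootSpace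
        (adjointGroup_map_lie hm) (X.E_mem α))
      have hc0 : c ≠ 0 := by
        rintro rfl
        rw [zero_smul] at hc
        exact X.E_ne_zero α (m.map_eq_zero_iff.mp hc)
      have h1 : n (m (X.E α)) = m (n (X.E α)) := hmc (n : L →ₗ[ℂ] L)
        (fun x => by simp [hlie, hE j hj]) (fun x => by simp [hlie, hneg j (hE j hj)]) (X.E α)
      rw [hα, hc, map_smul] at h1
      exact smul_right_injective L hc0 h1
  rw [← X.expansion x]
  simp [hall, hnH]

end Representatives

end RealFormTheory

namespace RealFormTheory

/-! ### Lengths and inversions -/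

section Length

variable {L : Type*} [LieRing L] [LieAlgebra ℂ L] [FiniteDimensional ℂ L] [IsKilling ℂ L]
variable {H : LieSubalgebra ℂ L} [H.IsCartanSubalgebra] {b : (rootSystem H).Base}

theorem indexEquiv_mul (w v : (rootSystem H).Aut) :
    (w * v).indexEquiv = w.indexEquiv * v.indexEquiv :=
  map_mul (RootPairing.Equiv.indexHom (rootSystem H)) w v

theorem indexEquiv_inv (w : (rootSystem H).Aut) : (w⁻¹).indexEquiv = w.indexEquiv⁻¹ :=
  map_inv (RootPairing.Equiv.indexHom (rootSystem H)) w

theorem reflectionPerm_mul_self (i : H.root) :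
    (rootSystem H).reflectionPerm i * (rootSystem H).reflectionPerm i = 1 := by
  ext1 α
  exact (rootSystem H).reflectionPerm_involutive i α

variable (b) in
open scoped Classical in
/-- The positive roots that the permutation `f` of the roots makes negative. -/
noncomputable def inversions (f : Equiv.Perm H.root) : Finset H.root :=
  {α | b.IsPos α ∧ ¬ b.IsPos (f α)}

theorem mem_inversions {f : Equiv.Perm H.root} {α : H.root} :
    α ∈ inversions b f ↔ b.IsPos α ∧ ¬ b.IsPos (f α) := by
  simp [inversions]

/-- The simple reflection permutes the positive roots other than `i` and negates `i`, so the
inversions are transported and `i` itself becomes a new one. -/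
theorem card_inversions_mul_reflectionPerm {f : Equiv.Perm H.root}
    (hf : ∀ α, f (negRoot α) = negRoot (f α)) {i : H.root} (hi : i ∈ b.support)
    (hfi : b.IsPos (f i)) :
    (inversions b (f * (rootSystem H).reflectionPerm i)).card = (inversions b f).card + 1 := by
  classical
  have hs : ∀ α, (rootSystem H).reflectionPerm i ((rootSystem H).reflectionPerm i α) = α :=
    fun α => (rootSystem H).reflectionPerm_involutive i α
  have h1 : inversions b (f * (rootSystem H).reflectionPerm i) =
      insert i ((inversions b f).image ((rootSystem H).reflectionPerm i)) := by
    ext α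
    simp only [mem_inversions, Finset.mem_insert, Finset.mem_image, Equiv.Perm.mul_apply]
    constructor
    · rintro ⟨hα, hfα⟩
      by_cases hαi : α = i
      · exact Or.inl hαi
      · exact Or.inr ⟨_, ⟨hα.reflectionPerm hi hαi, hfα⟩, hs α⟩
    · rintro (rfl | ⟨β, ⟨hβ, hfβ⟩, rfl⟩)
      · refine ⟨b.isPos_of_mem_support hi, ?_⟩
        rw [reflectionPerm_self, hf, isPos_negRoot_iff, not_not]
        exact hfi
      · have hβi : β ≠ i := by rintro rfl; exact hfβ hfi
        exact ⟨hβ.reflectionPerm hi hβi, by rwa [hs]⟩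
  have h2 : i ∉ (inversions b f).image ((rootSystem H).reflectionPerm i) := by
    simp only [Finset.mem_image, mem_inversions, not_exists, not_and, and_imp]
    intro β hβ _ h
    have h3 : β = negRoot i := by rw [← hs β, h, reflectionPerm_self]
    rw [h3] at hβ
    exact isPos_negRoot_iff.mp hβ (b.isPos_of_mem_support hi)
  rw [h1, Finset.card_insert_of_notMem h2,
    Finset.card_image_of_injective _ (Equiv.injective _)]

theorem card_inversions_mul_reflectionPerm_of_not_isPos {f : Equiv.Perm H.root}
    (hf : ∀ α, f (negRoot α) = negRoot (f α)) {i : H.root} (hi : i ∈ b.support)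
    (hfi : ¬ b.IsPos (f i)) :
    (inversions b f).card = (inversions b (f * (rootSystem H).reflectionPerm i)).card + 1 := by
  have hs : ∀ α, (rootSystem H).reflectionPerm i (negRoot α) =
      negRoot ((rootSystem H).reflectionPerm i α) := fun α => by
    apply (rootSystem H).root.injective
    have h : ∀ α : H.root, (rootSystem H).root (negRoot α) = -(rootSystem H).root α := fun α => rfl
    rw [h, (rootSystem H).root_reflectionPerm, h, map_neg, (rootSystem H).root_reflectionPerm]
  have h := card_inversions_mul_reflectionPerm (b := b)
    (f := f * (rootSystem H).reflectionPerm i) (fun α => by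
      simp only [Equiv.Perm.mul_apply, hs, hf]) hi (by
      rw [Equiv.Perm.mul_apply, reflectionPerm_self, hf]
      exact isPos_negRoot_iff.mpr hfi)
  rwa [mul_assoc, reflectionPerm_mul_self, mul_one] at h

theorem isPos_apply_of_forall_simple {n : L ≃ₗ[ℂ] L} {f : Equiv.Perm H.root}
    (hf : ActsOnRoots n f) (h : ∀ i ∈ b.support, b.IsPos (f i)) {α : H.root} (hα : b.IsPos α) :
    b.IsPos (f α) :=
  hα.induction_on_add (p := fun α => b.IsPos (f α)) h
    fun _ j _ hk hi hj => hi.add (h j hj) (hf.map_add hk)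

theorem indexEquiv_reflection (i : H.root) :
    (RootPairing.Equiv.reflection (rootSystem H) i).indexEquiv =
      (rootSystem H).reflectionPerm i := rfl

/-- A representative in the adjoint group preserves the positive roots, hence fixes all simple
roots, and these form a basis of the dual of `H`. -/
theorem eq_one_of_forall_isPos (X : WeylBasis H) {w : (rootSystem H).Aut}
    (hw : w ∈ (rootSystem H).weylGroup) (h : ∀ α, b.IsPos α → b.IsPos (w.indexEquiv α)) :
    w = 1 := by
  obtain ⟨n, hn, hacts⟩ := exists_represents X hw
  apply RootPairing.Equiv.weightHom_injective
  apply LinearEquiv.toLinearMap_injective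
  refine b.toWeightBasis.ext fun i => ?_
  rw [b.toWeightBasis_apply]
  have h1 := RootPairing.Equiv.root_indexEquiv_eq_smul (P := rootSystem H) (i : H.root) w
  rw [hacts.apply_eq_self_of_mem_adjointGroup X hn h i.2] at h1
  exact h1.symm

/-- The product of the simple reflections in a word. -/
noncomputable def wordProd (l : List b.support) : (rootSystem H).Aut :=
  (l.map fun i : b.support => RootPairing.Equiv.reflection (rootSystem H) i.1).prod

theorem wordProd_append_singleton (l : List b.support) (i : b.support) :
    wordProd (l ++ [i]) = wordProd l * RootPairing.Equiv.reflection (rootSystem H) i.1 := by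
  simp [wordProd]

theorem wordProd_mem_weylGroup (l : List b.support) :
    wordProd l ∈ (rootSystem H).weylGroup :=
  Subgroup.list_prod_mem _ fun x hx => by
    obtain ⟨i, -, rfl⟩ := List.mem_map.mp hx
    exact (rootSystem H).reflection_mem_weylGroup _

theorem simpleLength_eq_sInf (w : (rootSystem H).Aut) :
    simpleLength b w = sInf {n | ∃ l : List b.support, l.length = n ∧ wordProd l = w} := by
  simp [simpleLength, wordProd, List.map_eq_flatMap, List.flatMap_assoc]

/-- Each further letter changes the number of inversions by exactly one. -/
theorem card_inversions_wordProd_le (X : WeylBasis H) (l : List b.support) :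
    (inversions b (wordProd l).indexEquiv).card ≤ l.length := by
  induction l using List.reverseRecOn with
  | nil =>
    have h : (wordProd ([] : List b.support)).indexEquiv = (1 : Equiv.Perm H.root) := rfl
    rw [h, Finset.card_eq_zero.mpr (Finset.eq_empty_of_forall_notMem fun α hα =>
      (mem_inversions.mp hα).2 (mem_inversions.mp hα).1)]
    simp
  | append_singleton l i ih =>
    obtain ⟨n, hn, hacts⟩ := exists_represents X (wordProd_mem_weylGroup l)
    rw [wordProd_append_singleton, indexEquiv_mul, indexEquiv_reflection, List.length_append,
      List.length_singleton]
    by_cases h : b.IsPos ((wordProd l).indexEquiv i.1)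
    · rw [card_inversions_mul_reflectionPerm hacts.map_neg i.2 h]
      omega
    · have := card_inversions_mul_reflectionPerm_of_not_isPos hacts.map_neg i.2 h
      omega

/-- Descent on the number of inversions: if it is positive, some simple root becomes negative, and
multiplying by its reflection removes one inversion. -/
theorem exists_word (X : WeylBasis H) {w : (rootSystem H).Aut}
    (hw : w ∈ (rootSystem H).weylGroup) :
    ∃ l : List b.support, l.length = (inversions b w.indexEquiv).card ∧
      wordProd l = w := by
  induction hN : (inversions b w.indexEquiv).card generalizing w with
  | zero =>
    refine ⟨[], rfl, ?_⟩
    refine (eq_one_of_forall_isPos (b := b) X hw fun α hα => ?_).symm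
    by_contra hc
    have := mem_inversions.mpr ⟨hα, hc⟩
    rw [Finset.card_eq_zero.mp hN] at this
    simp at this
  | succ N ih =>
    obtain ⟨n, hn, hacts⟩ := exists_represents X hw
    obtain ⟨i, hi, hwi⟩ : ∃ i ∈ b.support, ¬ b.IsPos (w.indexEquiv i) := by
      by_contra! hc
      obtain ⟨α, hα⟩ := Finset.card_pos.mp (N.succ_pos.trans_eq hN.symm)
      obtain ⟨hα, hwα⟩ := mem_inversions.mp hα
      exact hwα (isPos_apply_of_forall_simple hacts hc hα)
    have h1 := card_inversions_mul_reflectionPerm_of_not_isPos hacts.map_neg hi hwi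
    have hs := (rootSystem H).reflection_mem_weylGroup i
    obtain ⟨l, hl, hlw⟩ := ih (mul_mem hw hs) (by
      rw [indexEquiv_mul, indexEquiv_reflection]
      omega)
    refine ⟨l ++ [⟨i, hi⟩], by simp [hl], ?_⟩
    rw [wordProd_append_singleton, hlw, mul_assoc]
    have h2 := mul_inv_cancel (RootPairing.Equiv.reflection (rootSystem H) i)
    rw [RootPairing.Equiv.reflection_inv] at h2
    rw [h2, mul_one]

theorem simpleLength_eq_card_inversions (X : WeylBasis H) {w : (rootSystem H).Aut}
    (hw : w ∈ (rootSystem H).weylGroup) :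
    simpleLength b w = (inversions b w.indexEquiv).card := by
  obtain ⟨l, hl, hlw⟩ := exists_word (b := b) X hw
  rw [simpleLength_eq_sInf]
  refine le_antisymm (Nat.sInf_le ⟨l, hl, hlw⟩) (le_csInf ⟨_, l, hl, hlw⟩ ?_)
  rintro n ⟨l', rfl, rfl⟩
  exact card_inversions_wordProd_le X l'

theorem isLongest_longestElement (W' : Subgroup (rootSystem H).Aut) :
    IsLongest b W' (longestElement b W') :=
  (exists_isLongest b W').choose_spec

/-- Otherwise `w` times the reflection in `i` would be a longer element of `W'`. -/
theorem IsLongest.not_isPos_apply (X : WeylBasis H) {W' : Subgroup (rootSystem H).Aut}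
    (hW' : W' ≤ (rootSystem H).weylGroup) {w : (rootSystem H).Aut} (hw : IsLongest b W' w)
    {i : H.root} (hi : i ∈ b.support)
    (hs : RootPairing.Equiv.reflection (rootSystem H) i ∈ W') :
    ¬ b.IsPos (w.indexEquiv i) := fun hpos => by
  obtain ⟨n, hn, hacts⟩ := exists_represents X (hW' hw.1)
  have h1 := card_inversions_mul_reflectionPerm hacts.map_neg hi hpos
  have h2 := hw.2 _ (mul_mem hw.1 hs)
  rw [simpleLength_eq_card_inversions X (hW' hw.1),
    simpleLength_eq_card_inversions X (hW' (mul_mem hw.1 hs)), indexEquiv_mul,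
    indexEquiv_reflection] at h2
  omega

end Length

end RealFormTheory

namespace RealFormTheory

/-! ### The conjugations `θ` and `η₀` -/

section Conjugations

variable {L : Type*} [LieRing L] [LieAlgebra ℂ L] [FiniteDimensional ℂ L] [IsKilling ℂ L]
variable {H : LieSubalgebra ℂ L} [H.IsCartanSubalgebra] {b : (rootSystem H).Base}

theorem WeylBasis.induction (X : WeylBasis H)
    {p : L → Prop} (h0 : p 0) (hH : ∀ α : H.root, p (rootVec α : L))
    (hE : ∀ α, p (X.E α)) (hadd : ∀ x y, p x → p y → p (x + y))
    (hsmul : ∀ (c : ℂ) x, p x → p (c • x)) (x : L) : p x := by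
  rw [← X.expansion x]
  exact hadd _ _ (Finset.sum_induction _ p hadd h0 fun α _ => hsmul _ _ (hH α))
    (Finset.sum_induction _ p hadd h0 fun α _ => hsmul _ _ (hE α))

theorem compactConj_compactConj (X : WeylBasis H) (x : L) :
    X.compactConj (X.compactConj x) = x := by
  induction x using X.induction with
  | h0 => simp
  | hH α => simp [WeylBasis.compactConj_rootVec]
  | hE α => simp [WeylBasis.compactConj_E, WeylBasis.negRoot_negRoot]
  | hadd x y hx hy => rw [map_add, map_add, hx, hy]
  | hsmul c x hx => simp [map_smulₛₗ, hx]

theorem splitForm_splitForm (X : WeylBasis H) (x : L) :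
    X.splitForm (X.splitForm x) = x := by
  induction x using X.induction with
  | h0 => simp
  | hH α => simp [WeylBasis.splitForm_rootVec]
  | hE α => simp [WeylBasis.splitForm_E]
  | hadd x y hx hy => rw [map_add, map_add, hx, hy]
  | hsmul c x hx => simp [map_smulₛₗ, hx]

theorem compactConj_mem_cartan (X : WeylBasis H) (h : H) : X.compactConj (h : L) ∈ H := by
  rw [← WeylBasis.sum_rootVec h, map_sum]
  refine sum_mem fun α _ => ?_
  rw [map_smulₛₗ, WeylBasis.compactConj_rootVec]
  exact H.smul_mem _ (H.neg_mem (SetLike.coe_mem _))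

theorem rootVec_mem_splitTorus (α : H.root) : (rootVec α : L) ∈ splitTorus H :=
  Submodule.subset_span ⟨α, rfl⟩

theorem compactConj_of_mem_splitTorus (X : WeylBasis H) {x : L} (hx : x ∈ splitTorus H) :
    X.compactConj x = -x := by
  induction hx using Submodule.span_induction with
  | mem x hx => obtain ⟨α, rfl⟩ := hx; exact X.compactConj_rootVec α
  | zero => simp
  | add x y _ _ hx hy => rw [map_add, hx, hy]; abel
  | smul c x _ hx =>
    have h1 := X.compactConj.map_smulₛₗ (c : ℂ) x
    rw [hx, Complex.conj_ofReal, smul_neg] at h1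
    exact h1

theorem root_eq_of_forall_rootVec {α β : H.root}
    (h : ∀ γ : H.root, α.1 (rootVec γ) = β.1 (rootVec γ)) :
    α = β := by
  refine root_ext fun t => ?_
  have h1 : t = ∑ γ : H.root, γ.1 t • rootVec γ := Subtype.ext <| by
    simpa using (WeylBasis.sum_rootVec t).symm
  rw [h1, ← root_root_apply, ← root_root_apply, map_sum, map_sum]
  exact Finset.sum_congr rfl fun γ _ => by
    rw [map_smul, map_smul, root_root_apply, root_root_apply, h]

theorem rootVec_injective : Function.Injective (rootVec : H.root → H) := fun α β h => by
  refine root_ext fun t => ?_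
  rw [← WeylBasis.rootVec_form α t, ← WeylBasis.rootVec_form β t, h]

/-- The structure constants of a Weyl basis are real as soon as `θ` is an automorphism of the real
Lie algebra `L`; then `η₀` is one as well. -/
theorem splitForm_lie (X : WeylBasis H)
    (hθ : ∀ x y, X.compactConj ⁅x, y⁆ = ⁅X.compactConj x, X.compactConj y⁆) (x y : L) :
    X.splitForm ⁅x, y⁆ = ⁅X.splitForm x, X.splitForm y⁆ := by
  have hHE : ∀ α β : H.root, X.splitForm ⁅(rootVec α : L), X.E β⁆ = ⁅(rootVec α : L), X.E β⁆ :=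
    fun α β => by
      rw [mem_rootSpace_iff.mp (X.E_mem β), map_smulₛₗ, X.splitForm_E, WeylBasis.conj_root_rootVec]
  have hHH : ∀ α β : H.root, ⁅(rootVec α : L), (rootVec β : L)⁆ = 0 := fun α β =>
    congrArg Subtype.val (trivial_lie_zero H H (rootVec α) (rootVec β))
  have hEE : ∀ α β : H.root, X.splitForm ⁅X.E α, X.E β⁆ = ⁅X.E α, X.E β⁆ := fun α β => by
    by_cases hneg : β = negRoot α
    · rw [hneg, X.lie_E_neg, X.splitForm_rootVec]
    by_cases hadd : ∃ γ, (rootSystem H).root γ = (rootSystem H).root α + (rootSystem H).root β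
    · obtain ⟨γ, hγ⟩ := hadd
      have hγ' : (rootSystem H).root (negRoot γ) =
          (rootSystem H).root (negRoot α) + (rootSystem H).root (negRoot β) := by
        have h : ∀ α : H.root, (rootSystem H).root (negRoot α) = -(rootSystem H).root α :=
          fun α => rfl
        rw [h, h, h, hγ, neg_add]
      -- Comparing coefficients of E_{-γ} in θ[E_α, E_β] = [E_{-α}, E_{-β}], with m_{-α,-β} =
      -- -m_{α,β}, shows that m_{α,β} is real.
      have h1 := hθ (X.E α) (X.E β)
      rw [X.lie_E α β γ hγ, map_smulₛₗ, X.compactConj_E, X.compactConj_E, X.compactConj_E,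
        neg_lie, lie_neg, neg_neg, X.lie_E _ _ _ hγ', X.m_neg α β γ hγ, smul_neg, neg_smul,
        neg_inj] at h1
      rw [X.lie_E α β γ hγ, map_smulₛₗ, X.splitForm_E]
      exact congrArg (· • X.E γ) (smul_left_injective ℂ (X.E_ne_zero (negRoot γ)) h1)
    · have h0 : ⁅X.E α, X.E β⁆ = 0 := by
        by_contra h
        have hmem : ⁅X.E α, X.E β⁆ ∈ rootSpace H (α.1 + β.1 : H → ℂ) :=
          lie_mem_genWeightSpace_of_mem_genWeightSpace (X.E_mem α) (X.E_mem β)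
        let χ : LieModule.Weight ℂ H L := ⟨(α.1 + β.1 : H → ℂ), fun hbot => by
          have h0 : ⁅X.E α, X.E β⁆ ∈ (⊥ : LieSubmodule ℂ H L) := hbot ▸ hmem
          exact h ((LieSubmodule.mem_bot _).mp h0)⟩
        have hχ : χ.IsNonZero := fun h0 => hneg <| root_ext fun t => by
          have h3 : α.1 t + β.1 t = 0 := congrFun h0 t
          rw [negRoot_apply]
          linear_combination h3
        exact hadd ⟨⟨χ, by simpa using hχ⟩, by ext t; rfl⟩
      rw [h0, map_zero]
  induction x using X.induction with
  | h0 => simp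
  | hH α =>
    rw [X.splitForm_rootVec]
    induction y using X.induction with
    | h0 => simp
    | hH β => rw [X.splitForm_rootVec, hHH, map_zero]
    | hE β => rw [X.splitForm_E, hHE]
    | hadd y z hy hz => rw [lie_add, map_add, map_add, lie_add, hy, hz]
    | hsmul c y hy => rw [lie_smul, map_smulₛₗ, map_smulₛₗ, lie_smul, hy]
  | hE α =>
    rw [X.splitForm_E]
    induction y using X.induction with
    | h0 => simp
    | hH β => rw [X.splitForm_rootVec, ← lie_skew, map_neg, hHE]
    | hE β => rw [X.splitForm_E, hEE]
    | hadd y z hy hz => rw [lie_add, map_add, map_add, lie_add, hy, hz]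
    | hsmul c y hy => rw [lie_smul, map_smulₛₗ, map_smulₛₗ, lie_smul, hy]
  | hadd x z hx hz => rw [add_lie, map_add, map_add, add_lie, hx, hz]
  | hsmul c x hx => rw [smul_lie, map_smulₛₗ, map_smulₛₗ, smul_lie, hx]

/-- The permutation `α ↦ -α` of the roots. -/
noncomputable def negPerm : Equiv.Perm H.root :=
  ⟨negRoot, negRoot, WeylBasis.negRoot_negRoot, WeylBasis.negRoot_negRoot⟩

theorem negPerm_apply (α : H.root) : negPerm α = negRoot α := rfl

/-- The linear automorphism `θ η₀`, with `H_α ↦ -H_α` and `E_α ↦ -E_{-α}`. -/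
noncomputable def chevalleyInvolution (X : WeylBasis H) : L ≃ₗ[ℂ] L where
  toFun x := X.compactConj (X.splitForm x)
  map_add' x y := by rw [map_add, map_add]
  map_smul' c x := by rw [map_smulₛₗ, map_smulₛₗ, Complex.conj_conj, RingHom.id_apply]
  invFun x := X.splitForm (X.compactConj x)
  left_inv x := by simp only [compactConj_compactConj, splitForm_splitForm]
  right_inv x := by simp only [compactConj_compactConj, splitForm_splitForm]

theorem chevalleyInvolution_apply (X : WeylBasis H) (x : L) :
    chevalleyInvolution X x = X.compactConj (X.splitForm x) := rfl

theorem actsOnRoots_chevalleyInvolution (X : WeylBasis H) :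
    ActsOnRoots (chevalleyInvolution X) (negPerm : Equiv.Perm H.root) := by
  have h1 : ∀ h : H, chevalleyInvolution X h = ((-h : H) : L) := fun h => by
    have h2 : ∀ α : H.root, chevalleyInvolution X (rootVec α : L) = -(rootVec α : L) := fun α => by
      rw [chevalleyInvolution_apply, X.splitForm_rootVec, X.compactConj_rootVec]
    conv_lhs => rw [← WeylBasis.sum_rootVec h]
    rw [map_sum, NegMemClass.coe_neg, ← WeylBasis.sum_rootVec h, ← Finset.sum_neg_distrib]
    exact Finset.sum_congr rfl fun α _ => by rw [map_smul, h2, smul_neg]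
  refine ⟨fun h => h1 h ▸ SetLike.coe_mem _, fun α h => ?_⟩
  have h2 : (⟨chevalleyInvolution X h, h1 h ▸ SetLike.coe_mem _⟩ : H) = -h := Subtype.ext (h1 h)
  rw [h2, ← root_root_apply, map_neg, root_root_apply, negPerm_apply, negRoot_apply, neg_neg]

theorem chevalleyInvolution_lie (X : WeylBasis H)
    (hθ : ∀ x y, X.compactConj ⁅x, y⁆ = ⁅X.compactConj x, X.compactConj y⁆) (x y : L) :
    chevalleyInvolution X ⁅x, y⁆ = ⁅chevalleyInvolution X x, chevalleyInvolution X y⁆ := by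
  simp only [chevalleyInvolution_apply, splitForm_lie X hθ, hθ]

end Conjugations

end RealFormTheory

namespace RealFormTheory

/-! ### Iwasawa real forms -/

section RealForm

variable {L : Type*} [LieRing L] [LieAlgebra ℂ L]

theorem RealForm.apply_apply (τ : RealForm L) (x : L) : τ (τ x) = x := τ.involutive' x

theorem RealForm.apply_neg (τ : RealForm L) (x : L) : τ (-x) = -τ x := τ.toLinearMap.map_neg x

theorem RealForm.apply_add (τ : RealForm L) (x y : L) : τ (x + y) = τ x + τ y :=
  τ.toLinearMap.map_add x y

end RealForm

section Iwasawa

variable {L : Type*} [LieRing L] [LieAlgebra ℂ L] [FiniteDimensional ℂ L] [IsKilling ℂ L]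
variable {H : LieSubalgebra ℂ L} [H.IsCartanSubalgebra] {b : (rootSystem H).Base}
variable {X : WeylBasis H} {τ : RealForm L} {φ : L ≃ₗ⁅ℂ⁆ L}

theorem IsIwasawa.apply_mem_cartan (hτ : IsIwasawa X b τ) (h : H) : τ (h : L) ∈ H := by
  have h1 : τ (h : L) ∈ (fun x => τ x) '' (H : Set L) := ⟨h, h.2, rfl⟩
  rw [hτ.map_cartan] at h1
  exact h1

/-- The action on the roots of `φ = τ θ`: the root `τ α` is `-π α`. -/
theorem IsIwasawa.exists_actsOnRoots (hτ : IsIwasawa X b τ)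
    (hφ : ∀ x, φ x = τ (X.compactConj x)) :
    ∃ π : Equiv.Perm H.root, ActsOnRoots φ.toLinearEquiv π ∧ π * π = 1 := by
  have hmem : ∀ h : H, φ (h : L) ∈ H := fun h => by
    rw [hφ]
    exact hτ.apply_mem_cartan ⟨_, compactConj_mem_cartan X h⟩
  obtain ⟨π, hπ⟩ := RealFormTheory.exists_actsOnRoots (n := φ.toLinearEquiv) φ.map_lie hmem
  refine ⟨π, hπ, (hπ.mul hπ).unique ?_⟩
  have h1 : φ.toLinearEquiv * φ.toLinearEquiv = 1 := LinearEquiv.ext fun x => by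
    change φ (φ x) = x
    rw [hφ, hφ, ← hτ.comm, RealForm.apply_apply, compactConj_compactConj]
  rw [h1]
  exact ActsOnRoots.one

section

variable {π : Equiv.Perm H.root}

/-- On 𝔞 the conjugation θ is -1, so τ = -φ there. -/
theorem apply_tau_eq_neg (hφ : ∀ x, φ x = τ (X.compactConj x))
    (hπ : ActsOnRoots φ.toLinearEquiv π) (hππ : π * π = 1) {h h' : H}
    (hh : (h : L) ∈ splitTorus H) (hh' : (h' : L) = τ h) (α : H.root) :
    α.1 h' = -(π α).1 h := by
  obtain ⟨hn, hπ⟩ := hπ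
  have h1 : h' = -⟨φ.toLinearEquiv h, hn h⟩ := Subtype.ext <| by
    change (h' : L) = -φ (h : L)
    rw [hh', hφ, compactConj_of_mem_splitTorus X hh, RealForm.apply_neg, neg_neg]
  have h2 : α = π (π α) := (Equiv.Perm.congr_fun hππ α).symm
  rw [h1, ← hπ (π α) h, ← h2]
  exact ((rootSystem H).root α).map_neg _

theorem tau_rootVec (hφ : ∀ x, φ x = τ (X.compactConj x)) (hπ : ActsOnRoots φ.toLinearEquiv π)
    (α : H.root) : τ (rootVec α : L) = -(rootVec (π α) : L) := by
  have h1 : φ (rootVec α : L) = (rootVec (π α) : L) := hπ.apply_rootVec φ.map_lie α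
  rw [hφ, X.compactConj_rootVec, RealForm.apply_neg] at h1
  rw [← h1, neg_neg]

/-- The norm of `v` is the sum of the squares β(v)², which are real and nonnegative here. -/
theorem eq_zero_of_conj_root_apply {v : H} (hreal : ∀ β : H.root, conj (β.1 v) = β.1 v)
    (hv : killingForm ℂ L (v : L) (v : L) = 0) : v = 0 := by
  have h1 : killingForm ℂ L (v : L) (v : L) = ∑ β : H.root, β.1 v * β.1 v := by
    have h := congrArg (killingForm ℂ L (v : L)) (WeylBasis.sum_rootVec v)
    rw [map_sum] at h
    rw [← h]
    refine Finset.sum_congr rfl fun β _ => ?_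
    rw [map_smul, smul_eq_mul, LieModule.traceForm_comm, WeylBasis.rootVec_form]
  have h2 : ∀ β : H.root, β.1 v * β.1 v = (((β.1 v).re ^ 2 : ℝ) : ℂ) := fun β => by
    have := Complex.conj_eq_iff_re.mp (hreal β)
    conv_lhs => rw [← this]
    push_cast
    ring
  rw [h1, Finset.sum_congr rfl fun β _ => h2 β, ← Complex.ofReal_sum, Complex.ofReal_eq_zero,
    Finset.sum_eq_zero_iff_of_nonneg fun β _ => sq_nonneg _] at hv
  have h3 : ∀ β : H.root, β.1 v = 0 := fun β => by
    rw [← Complex.conj_eq_iff_re.mp (hreal β), pow_eq_zero_iff two_ne_zero |>.mp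
      (hv β (Finset.mem_univ β)), Complex.ofReal_zero]
  apply Subtype.ext
  rw [← WeylBasis.sum_rootVec v]
  simp [h3]

/-- Since τ maps H_α to -H_{πα}, the vector H_α - H_{πα} lies in 𝔞^τ. If α vanishes on it, so does
πα, and definiteness makes it zero. Conversely πα = α gives α = -α on 𝔞^τ. -/
theorem mem_vanishingRoots_iff (hφ : ∀ x, φ x = τ (X.compactConj x))
    (hπ : ActsOnRoots φ.toLinearEquiv π) (hππ : π * π = 1) {α : H.root} :
    α ∈ vanishingRoots H τ ↔ π α = α := by
  constructor
  · intro hα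
    have hππα : π (π α) = α := Equiv.Perm.congr_fun hππ α
    let v : H := rootVec α - rootVec (π α)
    have hvL : (v : L) = (rootVec α : L) - (rootVec (π α) : L) := rfl
    have hv : (v : L) ∈ splitTorus H :=
      Submodule.sub_mem _ (rootVec_mem_splitTorus _) (rootVec_mem_splitTorus _)
    have hτv : τ (v : L) = v := by
      rw [hvL, sub_eq_add_neg, RealForm.apply_add, RealForm.apply_neg, tau_rootVec hφ hπ,
        tau_rootVec hφ hπ, hππα]
      abel
    have h1 : α.1 v = 0 := hα v ⟨hv, hτv⟩
    have h2 : (π α).1 v = 0 := by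
      have := apply_tau_eq_neg hφ hπ hππ hv hτv.symm α
      rw [h1] at this
      exact neg_eq_zero.mp this.symm
    have h3 : v = 0 := by
      refine eq_zero_of_conj_root_apply (fun β => ?_) ?_
      · change conj ((rootSystem H).root β (rootVec α - rootVec (π α))) =
          (rootSystem H).root β (rootVec α - rootVec (π α))
        rw [map_sub, map_sub, root_root_apply, root_root_apply, WeylBasis.conj_root_rootVec,
          WeylBasis.conj_root_rootVec]
      · nth_rewrite 1 [hvL]
        rw [map_sub, LinearMap.sub_apply, WeylBasis.rootVec_form, WeylBasis.rootVec_form, h1, h2,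
          sub_zero]
    exact (rootVec_injective (sub_eq_zero.mp h3)).symm
  · rintro hα h ⟨hh, hτh⟩
    have h1 := apply_tau_eq_neg hφ hπ hππ hh (Eq.symm hτh) α
    rw [hα] at h1
    linear_combination h1 / 2

theorem vanishingRoots_eq (hτ : IsIwasawa X b τ) (hφ : ∀ x, φ x = τ (X.compactConj x))
    (hπ : ActsOnRoots φ.toLinearEquiv π) (hππ : π * π = 1) :
    vanishingRoots H τ = {α | ∀ h h' : H, (h : L) ∈ splitTorus H → (h' : L) = τ h →
      α.1 h' = -α.1 h} := by
  ext α
  rw [mem_vanishingRoots_iff hφ hπ hππ, Set.mem_ofPred_eq]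
  constructor
  · intro hα h h' hh hh'
    rw [apply_tau_eq_neg hφ hπ hππ hh hh', hα]
  · intro hα
    refine root_eq_of_forall_rootVec fun γ => ?_
    have hγ := rootVec_mem_splitTorus γ
    have h1 := hα (rootVec γ) ⟨_, hτ.apply_mem_cartan (rootVec γ)⟩ hγ rfl
    rw [apply_tau_eq_neg hφ hπ hππ hγ rfl] at h1
    exact neg_inj.mp h1

/-- This is the third Iwasawa condition, rewritten with τ(α) = -πα. -/
theorem isPos_negRoot_of_ne (hτ : IsIwasawa X b τ) (hφ : ∀ x, φ x = τ (X.compactConj x))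
    (hπ : ActsOnRoots φ.toLinearEquiv π) (hππ : π * π = 1) {α : H.root} (hα : b.IsPos α)
    (hne : π α ≠ α) : b.IsPos (negRoot (π α)) := by
  have h1 : α ∉ vanishingRoots H τ := fun h =>
    hne ((mem_vanishingRoots_iff hφ hπ hππ).mp h)
  obtain ⟨β, hβ, hβα⟩ := hτ.compatible α hα (by simpa [vanishingRoots] using h1)
  convert hβ
  refine root_eq_of_forall_rootVec fun γ => ?_
  have hγ := rootVec_mem_splitTorus γ
  rw [hβα (rootVec γ) ⟨_, hτ.apply_mem_cartan (rootVec γ)⟩ hγ rfl,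
    apply_tau_eq_neg hφ hπ hππ hγ (h' := ⟨_, hτ.apply_mem_cartan (rootVec γ)⟩) rfl,
    negRoot_apply]

/-- Realizing the height as evaluation at a vector makes it linear, so identities between roots pass
to heights. -/
theorem exists_forall_apply_eq_height (b : (rootSystem H).Base) :
    ∃ h : H, ∀ α : H.root, α.1 h = b.height α := by
  obtain ⟨h, hh⟩ := exists_forall_simple_apply_eq b fun _ => 1
  refine ⟨h, fun α => ?_⟩
  have key : ∀ β, b.IsPos β → β.1 h = b.height β := fun β hβ =>
    hβ.induction_on_add (p := fun β => β.1 h = b.height β)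
      (fun i hi => by rw [hh ⟨i, hi⟩, b.height_one_of_mem_support hi, Int.cast_one])
      fun i j k hk hi hj => by
        rw [b.height_add hk, b.height_one_of_mem_support hj, ← root_root_apply, hk,
          LinearMap.add_apply, root_root_apply, root_root_apply, hi, hh ⟨j, hj⟩]
        push_cast
        rfl
  rcases WeylBasis.isPos_or_isPos_negRoot b α with hα | hα
  · exact key α hα
  · have h1 := key _ hα
    rw [negRoot_apply, height_negRoot, Int.cast_neg] at h1
    exact neg_injective h1

theorem ActsOnRoots.exists_apply_eq_height (b : (rootSystem H).Base) {n : L ≃ₗ[ℂ] L}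
    (hπ : ActsOnRoots n π) : ∃ s : H, ∀ α : H.root, α.1 s = b.height (π α) := by
  obtain ⟨h, hh⟩ := exists_forall_apply_eq_height b
  obtain ⟨hn, hπ⟩ := hπ
  obtain ⟨s, hs⟩ := exists_mem_eq_apply hn h
  have h1 : h = ⟨n s, hn s⟩ := Subtype.ext hs.symm
  exact ⟨s, fun α => by rw [← hh, ← hπ α s, ← h1]⟩

variable (b) in
/-- The number `ht α - ht (π α)`, which is `ht α + ht (τ α)`. -/
noncomputable def heightDrop (π : Equiv.Perm H.root) (α : H.root) : ℤ :=
  b.height α - b.height (π α)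

theorem ActsOnRoots.exists_apply_eq_heightDrop (b : (rootSystem H).Base) {n : L ≃ₗ[ℂ] L}
    (hπ : ActsOnRoots n π) : ∃ z : H, ∀ α : H.root, α.1 z = heightDrop b π α := by
  obtain ⟨h, hh⟩ := exists_forall_apply_eq_height b
  obtain ⟨s, hs⟩ := hπ.exists_apply_eq_height b
  refine ⟨h - s, fun α => ?_⟩
  rw [← root_root_apply, LinearMap.map_sub, root_root_apply, root_root_apply, hh, hs]
  simp [heightDrop]

theorem vanishingWeylGroup_le : vanishingWeylGroup H τ ≤ (rootSystem H).weylGroup :=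
  Subgroup.closure_mono (Set.image_subset_range _ _)

/-- A reflection in Δ₀ changes a root by a multiple of a root that is zero at `z`. -/
theorem apply_eq_of_mem_vanishingWeylGroup {z : H}
    (hz : ∀ α ∈ vanishingRoots H τ, α.1 z = 0) {w : (rootSystem H).Aut}
    (hw : w ∈ vanishingWeylGroup H τ) (α : H.root) : (w.indexEquiv α).1 z = α.1 z := by
  induction hw using Subgroup.closure_induction generalizing α with
  | mem w hw =>
    obtain ⟨β, hβ, rfl⟩ := hw
    rw [indexEquiv_reflection, ← root_root_apply, (rootSystem H).root_reflectionPerm,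
      RootPairing.reflection_apply_root]
    simp [hz β hβ]
  | one => rfl
  | mul w v _ _ hw hv => rw [indexEquiv_mul, Equiv.Perm.mul_apply, hw, hv]
  | inv w _ hw =>
    rw [← hw, indexEquiv_inv]
    exact congrArg (fun β : H.root => β.1 z) (w.indexEquiv.apply_symm_apply α)

end

end Iwasawa

end RealFormTheory

namespace RealFormTheory

section Main

variable {L : Type*} [LieRing L] [LieAlgebra ℂ L] [FiniteDimensional ℂ L] [IsKilling ℂ L]
variable {H : LieSubalgebra ℂ L} [H.IsCartanSubalgebra] {b : (rootSystem H).Base}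
variable {X : WeylBasis H} {τ : RealForm L} {φ : L ≃ₗ⁅ℂ⁆ L} {π : Equiv.Perm H.root}

/-! ### The diagram automorphism attached to an Iwasawa real form -/

theorem heightDrop_eq_zero {α : H.root} (hα : π α = α) : heightDrop b π α = 0 := by
  rw [heightDrop, hα, sub_self]

theorem heightDrop_negRoot (hπ : ActsOnRoots φ.toLinearEquiv π) (α : H.root) :
    heightDrop b π (negRoot α) = -heightDrop b π α := by
  rw [heightDrop, heightDrop, hπ.map_neg, height_negRoot, height_negRoot]
  ring

theorem heightDrop_pos (hτ : IsIwasawa X b τ) (hφ : ∀ x, φ x = τ (X.compactConj x))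
    (hπ : ActsOnRoots φ.toLinearEquiv π) (hππ : π * π = 1) {α : H.root} (hα : b.IsPos α)
    (hne : π α ≠ α) : 0 < heightDrop b π α := by
  have h1 := one_le_height (isPos_negRoot_of_ne hτ hφ hπ hππ hα hne)
  have h2 := one_le_height hα
  rw [height_negRoot] at h1
  rw [heightDrop]
  omega

theorem heightDrop_nonneg (hτ : IsIwasawa X b τ) (hφ : ∀ x, φ x = τ (X.compactConj x))
    (hπ : ActsOnRoots φ.toLinearEquiv π) (hππ : π * π = 1) {α : H.root} (hα : b.IsPos α) :
    0 ≤ heightDrop b π α := by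
  by_cases h : π α = α
  · exact (heightDrop_eq_zero h).ge
  · exact (heightDrop_pos hτ hφ hπ hππ hα h).le

theorem heightDrop_apply_of_mem_vanishingWeylGroup (hφ : ∀ x, φ x = τ (X.compactConj x))
    (hπ : ActsOnRoots φ.toLinearEquiv π) (hππ : π * π = 1) {w : (rootSystem H).Aut}
    (hw : w ∈ vanishingWeylGroup H τ) (α : H.root) :
    heightDrop b π (w.indexEquiv α) = heightDrop b π α := by
  obtain ⟨z, hz⟩ := hπ.exists_apply_eq_heightDrop b
  have h1 := apply_eq_of_mem_vanishingWeylGroup (z := z) (fun β hβ => by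
    rw [hz, heightDrop_eq_zero ((mem_vanishingRoots_iff hφ hπ hππ).mp hβ), Int.cast_zero]) hw α
  rw [hz, hz] at h1
  exact_mod_cast h1

/-- The height drop is additive, nonnegative on simple roots and zero on α, so every simple root
that occurs in α has drop zero, that is, belongs to Δ₀. The longest element makes each of these
negative, hence also α. -/
theorem not_isPos_longestElement_apply (hτ : IsIwasawa X b τ)
    (hφ : ∀ x, φ x = τ (X.compactConj x)) (hπ : ActsOnRoots φ.toLinearEquiv π) (hππ : π * π = 1)
    {α : H.root} (hα : b.IsPos α) (hfix : π α = α) :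
    ¬ b.IsPos ((longestElement b (vanishingWeylGroup H τ)).indexEquiv α) := by
  have hw := isLongest_longestElement (b := b) (vanishingWeylGroup H τ)
  set w := longestElement b (vanishingWeylGroup H τ)
  obtain ⟨n, -, hn⟩ := exists_represents X (vanishingWeylGroup_le hw.1)
  obtain ⟨z, hz⟩ := hπ.exists_apply_eq_heightDrop b
  obtain ⟨s, hs⟩ := hn.exists_apply_eq_height b
  obtain ⟨k, hk⟩ := exists_eq_sum_nat_of_isPos hα
  have hnonneg : ∀ i ∈ b.support, 0 ≤ (k i : ℤ) * heightDrop b π i := fun i hi =>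
    mul_nonneg (Int.natCast_nonneg _)
      (heightDrop_nonneg hτ hφ hπ hππ (b.isPos_of_mem_support hi))
  have hsum : ∑ i ∈ b.support, (k i : ℤ) * heightDrop b π i = 0 := by
    have h1 := hk z
    simp only [hz] at h1
    rw [heightDrop_eq_zero hfix] at h1
    exact_mod_cast h1.symm
  have hzero := (Finset.sum_eq_zero_iff_of_nonneg hnonneg).mp hsum
  have hheight : b.height (w.indexEquiv α) =
      ∑ i ∈ b.support, (k i : ℤ) * b.height (w.indexEquiv i) := by
    have h1 := hk s
    simp only [hs] at h1
    exact_mod_cast h1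
  rw [RootPairing.Base.isPos_iff, hheight, not_lt]
  refine Finset.sum_nonpos fun i hi => ?_
  rcases mul_eq_zero.mp (hzero i hi) with h | h
  · rw [h, zero_mul]
  · have hi' : π i = i := by
      by_contra hne
      exact (heightDrop_pos hτ hφ hπ hππ (b.isPos_of_mem_support hi) hne).ne' h
    refine mul_nonpos_of_nonneg_of_nonpos (Int.natCast_nonneg _) (not_lt.mp ?_)
    exact hw.not_isPos_apply X vanishingWeylGroup_le hi
      (Subgroup.subset_closure ⟨i, (mem_vanishingRoots_iff hφ hπ hππ).mpr hi', rfl⟩)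

/-- The root β = -w₀⁻¹πα has the same height drop as α. If β were negative, this drop would be both
nonpositive and nonnegative, so α and β would be fixed by π. But then w₀ sends the positive root -β
of Δ₀ to the positive root α, which is impossible. -/
theorem isPos_diagramPerm_apply (hτ : IsIwasawa X b τ)
    (hφ : ∀ x, φ x = τ (X.compactConj x)) (hπ : ActsOnRoots φ.toLinearEquiv π) (hππ : π * π = 1)
    {α : H.root} (hα : b.IsPos α) :
    b.IsPos (((longestElement b (vanishingWeylGroup H τ)).indexEquiv⁻¹ * π * negPerm :
      Equiv.Perm H.root) α) := by
  have hw := (isLongest_longestElement (b := b) (vanishingWeylGroup H τ)).1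
  have hneg := fun α => not_isPos_longestElement_apply hτ hφ hπ hππ (b := b) (α := α)
  set w := longestElement b (vanishingWeylGroup H τ)
  set β := (w.indexEquiv⁻¹ * π * negPerm : Equiv.Perm H.root) α with hβ
  have hwβ : w.indexEquiv β = negRoot (π α) := by
    rw [hβ, Equiv.Perm.mul_apply, Equiv.Perm.mul_apply, negPerm_apply, hπ.map_neg,
      ← Equiv.Perm.mul_apply, mul_inv_cancel, Equiv.Perm.one_apply]
  have hdrop : heightDrop b π β = heightDrop b π α := by
    rw [← heightDrop_apply_of_mem_vanishingWeylGroup hφ hπ hππ hw, hwβ, heightDrop_negRoot hπ,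
      heightDrop, heightDrop, ← Equiv.Perm.mul_apply, hππ, Equiv.Perm.one_apply]
    ring
  by_contra hβpos
  have hβneg := isPos_negRoot_iff.mpr hβpos
  have h1 := heightDrop_nonneg hτ hφ hπ hππ hβneg
  rw [heightDrop_negRoot hπ, hdrop] at h1
  have hfix : π α = α := by
    by_contra hne
    have := heightDrop_pos hτ hφ hπ hππ hα hne
    omega
  have hfix' : π (negRoot β) = negRoot β := by
    by_contra hne
    have := heightDrop_pos hτ hφ hπ hππ hβneg hne
    rw [heightDrop_negRoot hπ, hdrop, heightDrop_eq_zero hfix] at this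
    omega
  obtain ⟨n, -, hn⟩ := exists_represents X (vanishingWeylGroup_le hw)
  refine hneg _ hβneg hfix' ?_
  rwa [hn.map_neg, hwβ, hfix, WeylBasis.negRoot_negRoot]

/-- Let κ be the action of gφ, which extends d. The element ν⁻¹n₀⁻¹g⁻¹ of the adjoint group sends κα
to (w⁰)⁻¹w₀⁻¹πα. Both -w⁰ and σ = -w₀⁻¹π preserve positivity, so this element does too. It then
fixes the simple root d i, and w₀⁻¹π i = w⁰d i. -/
theorem diagramPerm_apply_eq_negLongest {d : Equiv.Perm b.support} (hτ : IsIwasawa X b τ)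
    (hφ : ∀ x, φ x = τ (X.compactConj x)) (hd : HasOuterClass b φ d)
    (hπ : ActsOnRoots φ.toLinearEquiv π) (hππ : π * π = 1) (i : b.support) :
    ((longestElement b (vanishingWeylGroup H τ)).indexEquiv⁻¹ * π * negPerm :
      Equiv.Perm H.root) i =
      negLongest b d i := by
  have hσpos := fun α => isPos_diagramPerm_apply hτ hφ hπ hππ (α := α)
  have hw₀ := (isLongest_longestElement (b := b) (vanishingWeylGroup H τ)).1
  set w₀ := longestElement b (vanishingWeylGroup H τ)
  have hlong := isLongest_longestElement (b := b) (rootSystem H).weylGroup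
  rw [negLongest]
  set w := longestElement b (rootSystem H).weylGroup
  obtain ⟨g, hg, hgH, hgE⟩ := hd
  obtain ⟨n₀, hn₀, hn₀w⟩ := exists_represents X (vanishingWeylGroup_le hw₀)
  obtain ⟨ν, hν, hνw⟩ := exists_represents X hlong.1
  have hlie : ∀ x y, (g * φ.toLinearEquiv) ⁅x, y⁆ =
      ⁅(g * φ.toLinearEquiv) x, (g * φ.toLinearEquiv) y⁆ := fun x y => by
    change g (φ ⁅x, y⁆) = ⁅g (φ x), g (φ y)⁆
    rw [φ.map_lie, adjointGroup_map_lie hg]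
  obtain ⟨κ, hκ⟩ := exists_actsOnRoots hlie fun h => by
    have h1 : g (φ (h : L)) ∈ (fun x => g (φ x)) '' (H : Set L) := ⟨h, h.2, rfl⟩
    rw [hgH] at h1
    exact h1
  have hκd : ∀ j : b.support, κ j = d j := fun j =>
    hκ.eq_of_apply_mem_rootSpace hlie (X.E_mem j) (X.E_ne_zero j) <| by
      have h1 : g (φ (X.E j)) ∈ (fun x => g (φ x)) '' (rootSpace H (j : H.root).1 : Set L) :=
        ⟨_, X.E_mem j, rfl⟩
      rw [hgE] at h1
      exact h1
  have hκpos : ∀ α, b.IsPos α → b.IsPos (κ α) := fun α =>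
    isPos_apply_of_forall_simple hκ fun j hj => by
      rw [hκd ⟨j, hj⟩]
      exact b.isPos_of_mem_support (d ⟨j, hj⟩).2
  have hf := hνw.mul (actsOnRoots_chevalleyInvolution X)
  have hfpos : ∀ α, b.IsPos α → b.IsPos ((w.indexEquiv * negPerm : Equiv.Perm H.root) α) := fun α =>
    isPos_apply_of_forall_simple hf fun j hj => by
      rw [Equiv.Perm.mul_apply, negPerm_apply, hνw.map_neg, isPos_negRoot_iff]
      exact hlong.not_isPos_apply X le_rfl hj ((rootSystem H).reflection_mem_weylGroup j)
  have hg' : ν⁻¹ * n₀⁻¹ * g⁻¹ ∈ adjointGroup L :=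
    mul_mem (mul_mem (inv_mem hν) (inv_mem hn₀)) (inv_mem hg)
  have hgacts : ActsOnRoots g (κ * π⁻¹) := by
    have h1 := hκ.mul hπ.inv
    rwa [mul_inv_cancel_right] at h1
  have hacts := (hνw.inv.mul hn₀w.inv).mul hgacts.inv
  have happly : ∀ α, (w.indexEquiv⁻¹ * w₀.indexEquiv⁻¹ * (κ * π⁻¹)⁻¹ : Equiv.Perm H.root) (κ α) =
      w.indexEquiv⁻¹ (w₀.indexEquiv⁻¹ (π α)) := fun α => by
    simp [mul_inv_rev]
  have hσ : ∀ α, (w₀.indexEquiv⁻¹ * π * negPerm : Equiv.Perm H.root) α = negRoot (w₀.indexEquiv⁻¹ (π α)) :=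
    fun α => by
      rw [Equiv.Perm.mul_apply, Equiv.Perm.mul_apply, negPerm_apply, hπ.map_neg,
        hn₀w.inv.map_neg]
  have hpos : ∀ α, b.IsPos α →
      b.IsPos ((w.indexEquiv⁻¹ * w₀.indexEquiv⁻¹ * (κ * π⁻¹)⁻¹ : Equiv.Perm H.root) α) := fun α hα => by
    obtain ⟨α, rfl⟩ := κ.surjective α
    have h1 := hσpos α (hκ.isPos_of_isPos_apply hκpos hα)
    rw [happly]
    refine hf.isPos_of_isPos_apply hfpos ?_
    rwa [Equiv.Perm.mul_apply, negPerm_apply, hνw.map_neg, ← Equiv.Perm.mul_apply,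
      mul_inv_cancel, Equiv.Perm.one_apply, ← hσ]
  have h1 := hacts.apply_eq_self_of_mem_adjointGroup X hg' hpos (d i).2
  rw [← hκd, happly, Equiv.Perm.inv_eq_iff_eq] at h1
  rw [hσ, h1, hκd]

/-! ### Existence and uniqueness of the diagram lift -/

theorem IsDiagramLift.unique {c : b.support → H.root} {γ γ' : L ≃ₗ⁅ℂ⁆ L}
    (h : IsDiagramLift X b c γ) (h' : IsDiagramLift X b c γ') : γ = γ' := by
  have key := eq_self_of_fixes_simple (b := b) X (n := γ.toLinearEquiv.trans γ'.symm.toLinearEquiv)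
    (fun x y => by
      change γ'.symm (γ ⁅x, y⁆) = ⁅γ'.symm (γ x), γ'.symm (γ y)⁆
      rw [γ.map_lie, γ'.symm.map_lie])
    (fun i hi => by
      change γ'.symm (γ (rootVec i : L)) = (rootVec i : L)
      rw [(h ⟨i, hi⟩).1, ← (h' ⟨i, hi⟩).1]
      exact γ'.symm_apply_apply _)
    (fun i hi => by
      change γ'.symm (γ (X.E i)) = X.E i
      rw [(h ⟨i, hi⟩).2, ← (h' ⟨i, hi⟩).2]
      exact γ'.symm_apply_apply _)
  ext x
  have h1 : γ'.symm (γ x) = x := key x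
  rw [← h1, γ'.apply_symm_apply, h1]

/-- The conjugate η₀γη₀ is complex linear and a lift of the same map, so it equals γ by uniqueness.
-/
theorem IsDiagramLift.splitForm_comm {c : b.support → H.root} {γ : L ≃ₗ⁅ℂ⁆ L}
    (hθ : ∀ x y, X.compactConj ⁅x, y⁆ = ⁅X.compactConj x, X.compactConj y⁆)
    (h : IsDiagramLift X b c γ) (x : L) : X.splitForm (γ x) = γ (X.splitForm x) := by
  let γ' : L ≃ₗ⁅ℂ⁆ L :=
    { toFun := fun x => X.splitForm (γ (X.splitForm x))
      map_add' := fun x y => by simp only [map_add]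
      map_smul' := fun a x => by simp [map_smulₛₗ]
      map_lie' := fun {x y} => by simp only [splitForm_lie X hθ, γ.map_lie]
      invFun := fun x => X.splitForm (γ.symm (X.splitForm x))
      left_inv := fun x => by simp [splitForm_splitForm]
      right_inv := fun x => by simp [splitForm_splitForm] }
  have h1 : IsDiagramLift X b c γ' := fun i => by
    constructor
    · change X.splitForm (γ (X.splitForm (rootVec (i : H.root) : L))) = _
      rw [X.splitForm_rootVec, (h i).1, X.splitForm_rootVec]
    · change X.splitForm (γ (X.splitForm (X.E i))) = _
      rw [X.splitForm_E, (h i).2, X.splitForm_E]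
  have h2 : X.splitForm (γ (X.splitForm (X.splitForm x))) = γ (X.splitForm x) :=
    congrArg (fun e : L ≃ₗ⁅ℂ⁆ L => e (X.splitForm x)) (h1.unique h)
  rwa [splitForm_splitForm] at h2

/-- An automorphism that permutes the root spaces can be corrected by an element of the torus to
a diagram lift. -/
theorem exists_isDiagramLift (X : WeylBasis H) (b : (rootSystem H).Base) {ψ : L ≃ₗ[ℂ] L}
    {σ : Equiv.Perm H.root} (hlie : ∀ x y, ψ ⁅x, y⁆ = ⁅ψ x, ψ y⁆) (hψ : ActsOnRoots ψ σ) :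
    ∃ t ∈ adjointGroup L, (∀ h : H, t h = h) ∧
      ∃ γ : L ≃ₗ⁅ℂ⁆ L, IsDiagramLift X b (fun i => σ i) γ ∧ ∀ x, γ x = t (ψ x) := by
  have h1 : ∀ i : b.support, ∃ c : ℂ, c ≠ 0 ∧ ψ (X.E i) = c • X.E (σ i) := fun i => by
    obtain ⟨c, hc⟩ := X.exists_eq_smul (hψ.apply_mem_rootSpace hlie (X.E_mem i))
    refine ⟨c, fun h0 => X.E_ne_zero i (ψ.injective ?_), hc⟩
    rw [hc, h0, zero_smul, map_zero]
  choose c hc0 hc using h1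
  obtain ⟨t, ht, htH, htE⟩ := exists_torus X hψ (fun i => (c i)⁻¹) fun i => inv_ne_zero (hc0 i)
  let γ : L ≃ₗ⁅ℂ⁆ L :=
    { t * ψ with
      map_lie' := fun {x y} => by
        change t (ψ ⁅x, y⁆) = ⁅t (ψ x), t (ψ y)⁆
        rw [hlie, adjointGroup_map_lie ht] }
  refine ⟨t, ht, htH, γ, fun i => ⟨?_, ?_⟩, fun x => rfl⟩
  · change t (ψ (rootVec (i : H.root) : L)) = _
    rw [hψ.apply_rootVec hlie, htH]
  · change t (ψ (X.E i)) = _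
    rw [hc, map_smul, htE, smul_smul, mul_inv_cancel₀ (hc0 i), one_smul]

theorem exists_lift_and_representative {d : Equiv.Perm b.support} (hτ : IsIwasawa X b τ)
    (hφ : ∀ x, φ x = τ (X.compactConj x)) (hd : HasOuterClass b φ d)
    (hπ : ActsOnRoots φ.toLinearEquiv π) (hππ : π * π = 1) :
    ∃ γ : L ≃ₗ⁅ℂ⁆ L, IsDiagramLift X b (negLongest b d) γ ∧
      ∃ n ∈ adjointGroup L, Represents n (longestElement b (vanishingWeylGroup H τ)) ∧
        ∀ x : L, τ x = n (X.splitForm (γ x)) := by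
  have hσ := funext (diagramPerm_apply_eq_negLongest hτ hφ hd hπ hππ)
  have hw₀ := (isLongest_longestElement (b := b) (vanishingWeylGroup H τ)).1
  set w₀ := longestElement b (vanishingWeylGroup H τ)
  obtain ⟨n₀, hn₀, hn₀w⟩ := exists_represents X (vanishingWeylGroup_le hw₀)
  -- That θ respects brackets is not part of the definition of a Weyl basis; it follows from θ = τφ.
  have hθφ : ∀ x, X.compactConj x = τ (φ x) := fun x => by rw [hφ, RealForm.apply_apply]
  have hθ : ∀ x y, X.compactConj ⁅x, y⁆ = ⁅X.compactConj x, X.compactConj y⁆ := fun x y => by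
    simp only [hθφ, φ.map_lie]
    exact τ.map_lie' _ _
  have hψ := (hn₀w.inv.mul hπ).mul (actsOnRoots_chevalleyInvolution X)
  -- The factor θη₀ acts by -1 on the roots, so `ψ` acts by σ = -w₀⁻¹π; it also turns φ = τθ into
  -- τη₀.
  set ψ := n₀⁻¹ * φ.toLinearEquiv * chevalleyInvolution X
  have hψη : ∀ x, n₀ (ψ x) = τ (X.splitForm x) := fun x => by
    change (n₀ * n₀⁻¹) (φ (X.compactConj (X.splitForm x))) = _
    rw [mul_inv_cancel, LinearEquiv.coe_one, id, hφ, compactConj_compactConj]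
  have hlie : ∀ x y, ψ ⁅x, y⁆ = ⁅ψ x, ψ y⁆ := fun x y => by
    change n₀⁻¹ (φ (chevalleyInvolution X ⁅x, y⁆)) = _
    rw [chevalleyInvolution_lie X hθ, φ.map_lie, adjointGroup_map_lie (inv_mem hn₀)]
    rfl
  obtain ⟨t, ht, htH, γ, hγ, hγt⟩ := exists_isDiagramLift X b hlie hψ
  rw [hσ] at hγ
  have htacts : ActsOnRoots t (1 : Equiv.Perm H.root) :=
    ⟨fun h => by rw [htH]; exact h.2, fun α h => congrArg α.1 (Subtype.ext (htH h))⟩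
  -- The torus correction is undone in the representative: `t` is trivial on `H`, so n₀t⁻¹ still
  -- represents w₀.
  refine ⟨γ, hγ, n₀ * t⁻¹, mul_mem hn₀ (inv_mem ht), ?_, fun x => ?_⟩
  · rw [represents_iff_actsOnRoots]
    have h1 := hn₀w.mul htacts.inv
    rwa [inv_one, mul_one] at h1
  · rw [hγ.splitForm_comm hθ, hγt]
    change τ x = n₀ ((t⁻¹ * t) (ψ (X.splitForm x)))
    rw [inv_mul_cancel, LinearEquiv.coe_one, id, hψη, splitForm_splitForm]

end Main

end RealFormTheory

/-! ### The main theorem -/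

theorem mainTheorem3 {L : Type*} [LieRing L] [LieAlgebra ℂ L] [FiniteDimensional ℂ L]
    [LieAlgebra.IsSemisimple ℂ L] (H : LieSubalgebra ℂ L) [H.IsCartanSubalgebra]
    (b : (LieAlgebra.IsKilling.rootSystem H).Base) (X : RealFormTheory.WeylBasis H)
    (d : Equiv.Perm b.support) (hd : RealFormTheory.IsDiagramAut b d) (hd2 : d * d = 1)
    (τ : RealFormTheory.RealForm L) (hτ : RealFormTheory.IsIwasawa X b τ)
    (hτd : RealFormTheory.IsInInnerClass X b τ d) :
    -- the two descriptions of `Δ₀` agree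
    RealFormTheory.vanishingRoots H τ =
      {α | ∀ h h' : H, (h : L) ∈ RealFormTheory.splitTorus H → (h' : L) = τ h →
        α.1 h' = -α.1 h} ∧
    -- the lift `γ` of `-w⁰ d` exists and is unique
    (∃! γ : L ≃ₗ⁅ℂ⁆ L, RealFormTheory.IsDiagramLift X b (RealFormTheory.negLongest b d) γ) ∧
    -- with `τ_d = η₀ γ`, `τ = Ad_n τ_d` for a representative `n` in `G` of `w₀`
    ∀ γ : L ≃ₗ⁅ℂ⁆ L, RealFormTheory.IsDiagramLift X b (RealFormTheory.negLongest b d) γ →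
      ∃ n ∈ RealFormTheory.adjointGroup L,
        RealFormTheory.Represents n
          (RealFormTheory.longestElement b (RealFormTheory.vanishingWeylGroup H τ)) ∧
        ∀ x : L, τ x = n (X.splitForm (γ x)) := by
  obtain ⟨φ, hφ, hφd⟩ := hτd
  obtain ⟨π, hπ, hππ⟩ := hτ.exists_actsOnRoots hφ
  refine ⟨RealFormTheory.vanishingRoots_eq hτ hφ hπ hππ, ?_⟩
  obtain ⟨γ, hγ, hn⟩ := RealFormTheory.exists_lift_and_representative hτ hφ hφd hπ hππ
  refine ⟨⟨γ, hγ, fun γ' hγ' => hγ'.unique hγ⟩, fun γ' hγ' => ?_⟩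
  rw [hγ'.unique hγ]
  exact hn
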